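/- **Lemma 4.2.** Surfaces are compact $2$-manifolds without boundary. An embedding of a graph in a surface is assumed to be cellular (every face is homeomorphic to an open disk), and it is called quadrangular if every face is bounded by a $4$-cycle; it is called orientable or nonorientable according to whether the surface is orientable or nonorientable. If the complete graph $K_n$ admits an orientable or a nonorientable quadrangular embedding, then $K_{n+4}$ admits a nonorientable quadrangular embedding. -/

import Mathlib

/-- A cellular embedding of a finite simple graph `G` in a closed surface (compact `2`-manifold
without boundary), presented in the standard way by a rotation system and edge signatures.

A local orientation of the surface is fixed at every vertex.  A dart is an edge of `G` with a chosen
direction, leaving its first vertex.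
* `rot` sends a dart leaving `v` to the next dart leaving `v` in the cyclic order around `v` given by
  the local orientation at `v`.  The darts leaving `v` form a single cycle of `rot`.
* `sign e` is `1` if the local orientations at the two ends of the edge `e` agree along `e`,
  and `-1` if they disagree.

Every choice of such data comes from a cellular embedding, unique up to homeomorphism: glue an open
disk along each facial walk (see `faceStep`). -/
structure CellularEmbedding {V : Type*} (G : SimpleGraph V) where
  rot : Equiv.Perm G.Dart
  rot_fst : ∀ d : G.Dart, (rot d).fst = d.fst
  rot_sameCycle : ∀ d d' : G.Dart, d.fst = d'.fst → rot.SameCycle d d'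
  sign : G.edgeSet → ℤˣ

namespace CellularEmbedding

variable {V : Type*} {G : SimpleGraph V}

/-- The signature of the edge underlying a dart. -/
def dartSign (Φ : CellularEmbedding G) (d : G.Dart) : ℤˣ :=
  Φ.sign ⟨d.edge, d.edge_mem⟩

/-- One step of face tracing.  A state `(d, ε)` says that the boundary of a face is being followed
and leaves the vertex `d.fst` along `d`, while the face lies on the side of `d` given by `ε`, relative
to the local orientation at `d.fst`.  Crossing `d` multiplies `ε` by the signature of `d`; at the
vertex `d.snd` one leaves along the successor (for `ε = 1`) or the predecessor (for `ε = -1`), in the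
rotation there, of the dart through which one came in.

The faces at non-isolated vertices are exactly the orbits of `faceStep`, where each face is traced in
both directions. -/
def faceStep (Φ : CellularEmbedding G) (x : G.Dart × ℤˣ) : G.Dart × ℤˣ :=
  ((Φ.rot ^ ((x.2 * Φ.dartSign x.1 : ℤˣ) : ℤ)) x.1.symm, x.2 * Φ.dartSign x.1)

/-- The face traced from the state `x` is bounded by a `k`-cycle (for `k ≥ 3`): the facial walk closes
up after `k` steps, and the `k` vertices on it are pairwise distinct. -/
def FaceBoundedByCycle (Φ : CellularEmbedding G) (k : ℕ) (x : G.Dart × ℤˣ) : Prop :=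
  Φ.faceStep^[k] x = x ∧
    Function.Injective (fun i : Fin k => (Φ.faceStep^[(i : ℕ)] x).1.fst)

/-- Every face is bounded by a `4`-cycle.  An isolated vertex lies on a sphere component whose only
face is bounded by a trivial walk, so there must be no isolated vertex. -/
def IsQuadrangular (Φ : CellularEmbedding G) : Prop :=
  (∀ v : V, ∃ w : V, G.Adj v w) ∧
    ∀ x : G.Dart × ℤˣ, Φ.FaceBoundedByCycle 4 x

/-- The surface is orientable: the local orientations at the vertices can be kept (`o v = 1`) or
reversed (`o v = -1`) so that afterwards they agree along every edge.  A disconnected surface is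
orientable if all of its components are. -/
def IsOrientable (Φ : CellularEmbedding G) : Prop :=
  ∃ o : V → ℤˣ, ∀ d : G.Dart, o d.fst * Φ.dartSign d * o d.snd = 1

/-- The surface is nonorientable. -/
def IsNonorientable (Φ : CellularEmbedding G) : Prop :=
  ¬ Φ.IsOrientable

end CellularEmbedding

/-- `G` has a quadrangular embedding in an orientable surface. -/
def HasOrientableQuadrangularEmbedding {V : Type*} (G : SimpleGraph V) : Prop :=
  ∃ Φ : CellularEmbedding G, Φ.IsQuadrangular ∧ Φ.IsOrientable

/-- `G` has a quadrangular embedding in a nonorientable surface. -/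
def HasNonorientableQuadrangularEmbedding {V : Type*} (G : SimpleGraph V) : Prop :=
  ∃ Φ : CellularEmbedding G, Φ.IsQuadrangular ∧ Φ.IsNonorientable

/-!
The enlargement from `n` to `n + 4` vertices is a diamond sum.  Given two quadrangulations and a vertex
of the same degree `k` in each, remove the two open stars, cutting every face at the vertex along the
diagonal that joins two consecutive neighbours, and glue the two boundary curves so that the
neighbours are identified.  Each face that was cut in the first surface fits together with one that was
cut in the second one, so that the result is again a quadrangulation
(`RotationSystem.Summable.isQuadrangulation`).

Let `J k` be the join of `k` independent vertices with the disjoint union of the complete graph on five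
vertices and one further vertex `z`, which thus has degree `k`.  The diamond sum of a quadrangulation
of the complete graph on `n` vertices with one of `J (n - 1)` at `z` replaces one vertex by five
pairwise adjacent vertices, each of them adjacent to the remaining `n - 1`; its graph is the complete
graph on `n + 4` vertices (`hasNonorientableQuadrangularEmbedding_add_four`).  The diamond sum of a
quadrangulation of `J k` with one of the complete bipartite graph with parts of sizes `4` and `6`, at
vertices of degree `6`, replaces one of the `k` independent vertices by three and so gives one of
`J (k + 2)` (`HasJoinQuadrangulation.step`).  Hence explicit quadrangulations of `J 3` and `J 4` suffice
for all `k ≥ 3`.  Both contain a triangle, within the five vertices, along which the orientation is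
reversed; diamond sums do not affect it, so that all surfaces obtained are nonorientable.

A quadrangular embedding of a nonempty complete graph has at least four vertices, and for the empty
graph the claim is that the complete graph on four vertices quadrangulates the projective plane.

The surgery is done on rotation systems in which the rotation at each vertex is a permutation of the
whole vertex type.  This makes it possible to have both summands on the same vertex type, and to write
the rotation of the sum as a product of permutations.
-/

/-! ### Rotation systems -/

/-- A rotation system with edge signatures on a vertex type `X`, with neither darts nor graph: `rot w`
permutes all of `X`, moves exactly the neighbours of `w`, and on them is the rotation at `w`; the
value `sgn w x` is relevant only when `w` and `x` are adjacent.  A vertex of degree `1` cannot be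
described in this way, but there is none in a quadrangulation. -/
structure RotationSystem (X : Type*) where
  rot : X → Equiv.Perm X
  sgn : X → X → ℤˣ

namespace RotationSystem

variable {X Y : Type*} {R R₁ R₂ D : RotationSystem X} {G G₁ G₂ : SimpleGraph X} {x₀ : X}

/-- The neighbour of `b` that follows (`ε = 1`) or precedes (`ε = -1`) the neighbour `a` in the
rotation at `b`. -/
def turn (R : RotationSystem X) (b : X) (ε : ℤˣ) (a : X) : X :=
  if ε = 1 then R.rot b a else (R.rot b).symm a

/-- Face tracing from the dart `a → b`, with the face on the side `ε` at `a`, runs through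
`a, b, c, d` and then closes up with the same side. -/
def IsFace (R : RotationSystem X) (a b c d : X) (ε : ℤˣ) : Prop :=
  R.turn b (ε * R.sgn a b) a = c ∧
    R.turn c (ε * R.sgn a b * R.sgn b c) b = d ∧
    R.turn d (ε * R.sgn a b * R.sgn b c * R.sgn c d) c = a ∧
    R.turn a ε d = b ∧
    R.sgn a b * R.sgn b c * R.sgn c d * R.sgn d a = 1

/-- `R` describes an embedding of `G` in which every face is a quadrilateral.  Isolated vertices of
`G` are allowed, and are ignored. -/
structure IsQuadrangulation (R : RotationSystem X) (G : SimpleGraph X) : Prop where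
  rot_ne_iff : ∀ w x, R.rot w x ≠ x ↔ G.Adj w x
  cyclic : ∀ w x y, G.Adj w x → G.Adj w y → ∃ i : ℕ, (R.rot w ^ i) x = y
  sgn_symm : ∀ w x, R.sgn w x = R.sgn x w
  face : ∀ a b, G.Adj a b → ∀ ε, ∃ c d, R.IsFace a b c d ε

@[simp] lemma turn_one (b a : X) : R.turn b 1 a = R.rot b a := by simp [turn]

@[simp] lemma turn_neg_one (b a : X) : R.turn b (-1) a = (R.rot b).symm a := by
  simp [turn]

lemma turn_neg_eq_iff (b : X) (ε : ℤˣ) (a c : X) : R.turn b (-ε) a = c ↔ R.turn b ε c = a := by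
  rcases Int.units_eq_one_or ε with rfl | rfl
  · rw [turn_neg_one, turn_one, Equiv.symm_apply_eq, eq_comm]
  · rw [neg_neg, turn_neg_one, turn_one, Equiv.symm_apply_eq, eq_comm]

lemma turn_eq_zpow (b : X) (ε : ℤˣ) (a : X) : R.turn b ε a = (R.rot b ^ (ε : ℤ)) a := by
  rcases Int.units_eq_one_or ε with rfl | rfl <;> simp

namespace IsQuadrangulation

lemma rot_eq_of_not_adj (h : R.IsQuadrangulation G) {w x : X} (hx : ¬ G.Adj w x) :
    R.rot w x = x := not_not.1 fun h' => hx ((h.rot_ne_iff w x).1 h')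

lemma adj_rot (h : R.IsQuadrangulation G) {w x : X} (hx : G.Adj w x) : G.Adj w (R.rot w x) := by
  rw [← h.rot_ne_iff] at hx ⊢
  exact fun h' => hx ((R.rot w).injective h')

lemma adj_rot_symm (h : R.IsQuadrangulation G) {w x : X} (hx : G.Adj w x) :
    G.Adj w ((R.rot w).symm x) := by
  rw [← h.rot_ne_iff] at hx ⊢
  intro h'
  apply hx
  rw [Equiv.apply_symm_apply, eq_comm, Equiv.symm_apply_eq] at h'
  exact h'.symm

lemma adj_turn (h : R.IsQuadrangulation G) {w x : X} (hx : G.Adj w x) (ε : ℤˣ) :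
    G.Adj w (R.turn w ε x) := by
  rcases Int.units_eq_one_or ε with rfl | rfl
  · simpa using h.adj_rot hx
  · simpa using h.adj_rot_symm hx

lemma turn_ne (h : R.IsQuadrangulation G) {w x : X} (hx : G.Adj w x) (ε : ℤˣ) :
    R.turn w ε x ≠ x := by
  have := (h.rot_ne_iff w x).2 hx
  rcases Int.units_eq_one_or ε with rfl | rfl
  · simpa using this
  · rw [turn_neg_one, Ne, Equiv.symm_apply_eq]
    exact fun h' => this h'.symm

end IsQuadrangulation

/-! ### The diamond sum -/

/-- The union of `G₁` and `G₂`, with all edges at `x₀` deleted. -/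
def diamondGraph (G₁ G₂ : SimpleGraph X) (x₀ : X) : SimpleGraph X where
  Adj w x := (G₁.Adj w x ∨ G₂.Adj w x) ∧ w ≠ x₀ ∧ x ≠ x₀
  symm := ⟨fun _ _ h => ⟨h.1.imp SimpleGraph.Adj.symm SimpleGraph.Adj.symm, h.2.2, h.2.1⟩⟩
  loopless := ⟨fun _ h => h.1.elim (G₁.irrefl) (G₂.irrefl)⟩

open Classical in
/-- The diamond sum at the common vertex `x₀` of two embeddings: the star of `x₀` is removed from both
surfaces, and the two boundary curves are glued along the neighbours of `x₀`.

If the rotation at a neighbour `w` of `x₀` is `(x₀ a₁ … aᵣ)` in the first and `(x₀ b₁ … bₛ)` in the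
second surface, then it is `(a₁ … aᵣ b₁ … bₛ)` in the sum.  The product of the two cycles is
`(x₀ b₁ … bₛ a₁ … aᵣ)`, and the transposition cuts `x₀` out of it. -/
noncomputable def diamond (R₁ R₂ : RotationSystem X) (G₁ : SimpleGraph X) (x₀ : X) :
    RotationSystem X where
  rot w := if w = x₀ then 1 else
    Equiv.swap x₀ ((R₁.rot w * R₂.rot w) x₀) * (R₁.rot w * R₂.rot w)
  sgn w x := if G₁.Adj w x then R₁.sgn w x else R₂.sgn w x

/-- The conditions under which the diamond sum at `x₀` is a quadrangulation.  The rotations at `x₀` are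
mutually inverse because the boundary curves of the two removed stars are glued with opposite
orientations. -/
structure Summable (R₁ R₂ : RotationSystem X) (G₁ G₂ : SimpleGraph X) (x₀ : X) : Prop where
  left : R₁.IsQuadrangulation G₁
  right : R₂.IsQuadrangulation G₂
  rot_right : R₂.rot x₀ = (R₁.rot x₀)⁻¹
  sgn_left : ∀ x, G₁.Adj x₀ x → R₁.sgn x₀ x = 1
  sgn_right : ∀ x, G₂.Adj x₀ x → R₂.sgn x₀ x = 1
  disjoint : ∀ w x, w ≠ x₀ → x ≠ x₀ → G₁.Adj w x → ¬ G₂.Adj w x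
  adj_of_adj : ∀ w x y, w ≠ x₀ → G₁.Adj w x → G₂.Adj w y → G₁.Adj w x₀

/-- `D` continues both rotation systems away from `x₀`, in the way the diamond sum does, expressed
symmetrically in the two summands. -/
structure Merges (D R₁ R₂ : RotationSystem X) (G₁ G₂ : SimpleGraph X) (x₀ : X) : Prop where
  turn_left : ∀ w a ε, w ≠ x₀ → a ≠ x₀ → R₁.turn w ε a ≠ x₀ → G₁.Adj w a →
    D.turn w ε a = R₁.turn w ε a
  turn_right : ∀ w a ε, w ≠ x₀ → a ≠ x₀ → R₂.turn w ε a ≠ x₀ → G₂.Adj w a →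
    D.turn w ε a = R₂.turn w ε a
  turn_left_right : ∀ w a ε, w ≠ x₀ → G₁.Adj w a → R₁.turn w ε a = x₀ →
    D.turn w ε a = R₂.turn w ε x₀
  turn_right_left : ∀ w a ε, w ≠ x₀ → G₂.Adj w a → R₂.turn w ε a = x₀ →
    D.turn w ε a = R₁.turn w ε x₀
  sgn_left : ∀ w x, w ≠ x₀ → x ≠ x₀ → G₁.Adj w x → D.sgn w x = R₁.sgn w x
  sgn_right : ∀ w x, w ≠ x₀ → x ≠ x₀ → G₂.Adj w x → D.sgn w x = R₂.sgn w x

lemma Merges.swap (h : D.Merges R₁ R₂ G₁ G₂ x₀) : D.Merges R₂ R₁ G₂ G₁ x₀ :=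
  ⟨h.turn_right, h.turn_left, h.turn_right_left, h.turn_left_right, h.sgn_right, h.sgn_left⟩

namespace Summable

lemma adj_iff (h : Summable R₁ R₂ G₁ G₂ x₀) (x : X) : G₂.Adj x₀ x ↔ G₁.Adj x₀ x := by
  rw [← h.left.rot_ne_iff, ← h.right.rot_ne_iff, h.rot_right, not_iff_not,
    Equiv.Perm.inv_eq_iff_eq, eq_comm]

lemma turn_right_eq (h : Summable R₁ R₂ G₁ G₂ x₀) (ε : ℤˣ) (x : X) :
    R₂.turn x₀ ε x = R₁.turn x₀ (-ε) x := by
  rcases Int.units_eq_one_or ε with rfl | rfl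
  · simp [h.rot_right, Equiv.Perm.inv_def]
  · simp [h.rot_right, Equiv.Perm.inv_def]

lemma swap (h : Summable R₁ R₂ G₁ G₂ x₀) : Summable R₂ R₁ G₂ G₁ x₀ where
  left := h.right
  right := h.left
  rot_right := by rw [h.rot_right, inv_inv]
  sgn_left := h.sgn_right
  sgn_right := h.sgn_left
  disjoint w x hw hx h₂ h₁ := h.disjoint w x hw hx h₁ h₂
  adj_of_adj w x y hw h₂ h₁ := by
    have := h.adj_of_adj w y x hw h₁ h₂
    exact ((h.adj_iff w).2 this.symm).symm

/-- A face of the first summand that avoids `x₀` survives.  A face with a corner `b, x₀, d` loses that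
corner, and the corner is replaced by the path `b, p, d` that is left over from the face of the
second summand with the same corner. -/
lemma exists_isFace (h : Summable R₁ R₂ G₁ G₂ x₀) (hD : D.Merges R₁ R₂ G₁ G₂ x₀) {a b : X}
    (hab : G₁.Adj a b) (ha : a ≠ x₀) (hb : b ≠ x₀) (ε : ℤˣ) : ∃ c d, D.IsFace a b c d ε := by
  obtain ⟨c, d, h₁, h₂, h₃, h₄, h₅⟩ := h.left.face a b hab ε
  have hbc : G₁.Adj b c := h₁ ▸ h.left.adj_turn hab.symm _
  have hcd : G₁.Adj c d := h₂ ▸ h.left.adj_turn hbc.symm _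
  have hda : G₁.Adj d a := h₃ ▸ h.left.adj_turn hcd.symm _
  have sab := hD.sgn_left a b ha hb hab
  by_cases hc : c = x₀
  · subst hc
    have hd : d ≠ c := hcd.ne'
    have s₁ : R₁.sgn b c = 1 := by rw [h.left.sgn_symm]; exact h.sgn_left b hbc.symm
    have s₂ : R₁.sgn c d = 1 := h.sgn_left d hcd
    rw [s₁, s₂] at h₃ h₅
    rw [s₁] at h₂
    simp only [mul_one] at h₂ h₃ h₅
    set e := ε * R₁.sgn a b with he
    have hcb₂ : G₂.Adj c b := (h.adj_iff b).2 hbc.symm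
    obtain ⟨p, q, k₁, k₂, k₃, k₄, k₅⟩ := h.right.face c b hcb₂ e
    have t₁ : R₂.sgn c b = 1 := h.sgn_right b hcb₂
    have hbp : G₂.Adj b p := k₁ ▸ h.right.adj_turn hcb₂.symm _
    have hpq : G₂.Adj p q := k₂ ▸ h.right.adj_turn hbp.symm _
    have hqc : G₂.Adj q c := k₃ ▸ h.right.adj_turn hpq.symm _
    have hp : p ≠ c := k₁ ▸ h.right.turn_ne hcb₂.symm _
    have hq : q = d := by
      rw [h.turn_right_eq, turn_neg_eq_iff] at k₄
      exact k₄.symm.trans h₂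
    subst hq
    have t₂ : R₂.sgn q c = 1 := by rw [h.right.sgn_symm]; exact h.sgn_right q hqc.symm
    rw [t₁] at k₁ k₂ k₃ k₅
    rw [t₂] at k₅
    simp only [mul_one, one_mul] at k₁ k₂ k₃ k₅
    have sbp := hD.sgn_right b p hb hp hbp
    have spq := hD.sgn_right p q hp hd hpq
    have sqa := hD.sgn_left q a hd ha hda
    refine ⟨p, q, ?_, ?_, ?_, ?_, ?_⟩
    · rw [sab, ← he, hD.turn_left_right b a e hb hab.symm h₁, k₁]
    · rw [sab, sbp, ← he, hD.turn_right p b _ hp hb (by rw [k₂]; exact hd) hbp.symm, k₂]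
    · rw [sab, sbp, spq, ← he, hD.turn_right_left q p _ hd hpq.symm k₃, mul_assoc, k₅, mul_one, h₃]
    · rw [hD.turn_left a q _ ha hd (by rw [h₄]; exact hb) hda.symm, h₄]
    · rw [sab, sbp, spq, sqa, mul_assoc (R₁.sgn a b), k₅, mul_one, h₅]
  by_cases hd : d = x₀
  · subst hd
    have s₁ : R₁.sgn c d = 1 := by rw [h.left.sgn_symm]; exact h.sgn_left c hcd.symm
    have s₂ : R₁.sgn d a = 1 := h.sgn_left a hda
    rw [s₁] at h₃
    rw [s₁, s₂] at h₅
    simp only [mul_one] at h₂ h₃ h₅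
    have he : ε * R₁.sgn a b * R₁.sgn b c = ε := by rw [mul_assoc, h₅, mul_one]
    rw [he] at h₂ h₃
    have hdc₂ : G₂.Adj d c := (h.adj_iff c).2 hcd.symm
    obtain ⟨p, q, k₁, k₂, k₃, k₄, k₅⟩ := h.right.face d c hdc₂ ε
    have t₁ : R₂.sgn d c = 1 := h.sgn_right c hdc₂
    have hcp : G₂.Adj c p := k₁ ▸ h.right.adj_turn hdc₂.symm _
    have hpq : G₂.Adj p q := k₂ ▸ h.right.adj_turn hcp.symm _
    have hqd : G₂.Adj q d := k₃ ▸ h.right.adj_turn hpq.symm _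
    have hp : p ≠ d := k₁ ▸ h.right.turn_ne hdc₂.symm _
    have hq : q = a := by
      rw [h.turn_right_eq, turn_neg_eq_iff] at k₄
      exact k₄.symm.trans h₃
    subst hq
    have t₂ : R₂.sgn q d = 1 := by rw [h.right.sgn_symm]; exact h.sgn_right q hqd.symm
    rw [t₁] at k₁ k₂ k₃ k₅
    rw [t₂] at k₅
    simp only [mul_one, one_mul] at k₁ k₂ k₃ k₅
    rw [mul_assoc, k₅, mul_one] at k₃
    have sbc := hD.sgn_left b c hb hc hbc
    have scp := hD.sgn_right c p hc hp hcp
    have spq := hD.sgn_right p q hp ha hpq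
    refine ⟨c, p, ?_, ?_, ?_, ?_, ?_⟩
    · rw [sab, hD.turn_left b q _ hb ha (by rw [h₁]; exact hc) hab.symm, h₁]
    · rw [sab, sbc, he, hD.turn_left_right c b _ hc hbc.symm h₂, k₁]
    · rw [sab, sbc, he, scp, hD.turn_right p c _ hp hc (by rw [k₂]; exact ha) hcp.symm, k₂]
    · rw [hD.turn_right_left q p _ ha hpq.symm k₃, h₄]
    · rw [sab, sbc, scp, spq, mul_assoc, k₅, mul_one, h₅]
  · have sbc := hD.sgn_left b c hb hc hbc
    have scd := hD.sgn_left c d hc hd hcd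
    have sda := hD.sgn_left d a hd ha hda
    refine ⟨c, d, ?_, ?_, ?_, ?_, ?_⟩
    · rw [sab, hD.turn_left b a _ hb ha (by rw [h₁]; exact hc) hab.symm, h₁]
    · rw [sab, sbc, hD.turn_left c b _ hc hb (by rw [h₂]; exact hd) hbc.symm, h₂]
    · rw [sab, sbc, scd, hD.turn_left d c _ hd hc (by rw [h₃]; exact ha) hcd.symm, h₃]
    · rw [hD.turn_left a d _ ha hd (by rw [h₄]; exact hb) hda.symm, h₄]
    · rw [sab, sbc, scd, sda, h₅]

/-! The four ways in which the rotation of the sum acts, away from `x₀`. -/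

lemma diamond_rot_left (h : Summable R₁ R₂ G₁ G₂ x₀) {w a : X} (hw : w ≠ x₀) (ha : a ≠ x₀)
    (hc : R₁.rot w a ≠ x₀) (hwa : G₁.Adj w a) :
    (diamond R₁ R₂ G₁ x₀).rot w a = R₁.rot w a := by
  classical
  have h₂ : R₂.rot w a = a := h.right.rot_eq_of_not_adj (h.disjoint w a hw ha hwa)
  simp only [diamond, if_neg hw, Equiv.Perm.mul_apply, h₂]
  refine Equiv.swap_apply_of_ne_of_ne hc fun h' => ha ?_
  have := (R₁.rot w).injective h'
  rw [← h₂] at this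
  exact (R₂.rot w).injective this

lemma diamond_rot_right (h : Summable R₁ R₂ G₁ G₂ x₀) {w a : X} (hw : w ≠ x₀) (ha : a ≠ x₀)
    (hc : R₂.rot w a ≠ x₀) (hwa : G₂.Adj w a) :
    (diamond R₁ R₂ G₁ x₀).rot w a = R₂.rot w a := by
  classical
  have h₁ : R₁.rot w (R₂.rot w a) = R₂.rot w a := h.left.rot_eq_of_not_adj
    fun h' => h.disjoint w _ hw hc h' (h.right.adj_rot hwa)
  simp only [diamond, if_neg hw, Equiv.Perm.mul_apply, h₁]
  refine Equiv.swap_apply_of_ne_of_ne hc fun h' => ha ?_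
  rw [← h₁] at h'
  exact (R₂.rot w).injective ((R₁.rot w).injective h')

lemma diamond_rot_left_right (h : Summable R₁ R₂ G₁ G₂ x₀) {w a : X} (hw : w ≠ x₀)
    (hwa : G₁.Adj w a) (hc : R₁.rot w a = x₀) :
    (diamond R₁ R₂ G₁ x₀).rot w a = R₂.rot w x₀ := by
  have hne : a ≠ x₀ := fun h' => (h.left.rot_ne_iff w a).2 hwa (hc.trans h'.symm)
  have h₂ : R₂.rot w a = a := h.right.rot_eq_of_not_adj (h.disjoint w a hw hne hwa)
  have hwx₁ : G₁.Adj w x₀ := hc ▸ h.left.adj_rot hwa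
  have hwx : G₂.Adj w x₀ := ((h.adj_iff w).2 hwx₁.symm).symm
  have h₁ : R₁.rot w (R₂.rot w x₀) = R₂.rot w x₀ := h.left.rot_eq_of_not_adj
    fun h' => h.disjoint w _ hw ((h.right.rot_ne_iff w x₀).2 hwx) h' (h.right.adj_rot hwx)
  simp only [diamond, if_neg hw, Equiv.Perm.mul_apply, h₂, hc, h₁, Equiv.swap_apply_left]

lemma diamond_rot_right_left (h : Summable R₁ R₂ G₁ G₂ x₀) {w a : X} (hw : w ≠ x₀)
    (hwa : G₂.Adj w a) (hc : R₂.rot w a = x₀) :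
    (diamond R₁ R₂ G₁ x₀).rot w a = R₁.rot w x₀ := by
  classical
  have hwx₂ : G₂.Adj w x₀ := hc ▸ h.right.adj_rot hwa
  have hwx : G₁.Adj w x₀ := ((h.adj_iff w).1 hwx₂.symm).symm
  simp only [diamond, if_neg hw, Equiv.Perm.mul_apply, hc]
  refine Equiv.swap_apply_of_ne_of_ne ((h.left.rot_ne_iff w x₀).2 hwx) fun h' => ?_
  exact (h.right.rot_ne_iff w x₀).2 hwx₂ ((R₁.rot w).injective h').symm

lemma merges (h : Summable R₁ R₂ G₁ G₂ x₀) : (diamond R₁ R₂ G₁ x₀).Merges R₁ R₂ G₁ G₂ x₀ where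
  turn_left w a ε hw ha hc hwa := by
    rcases Int.units_eq_one_or ε with rfl | rfl
    · simp only [turn_one] at hc ⊢
      exact h.diamond_rot_left hw ha hc hwa
    · simp only [turn_neg_one] at hc ⊢
      rw [Equiv.symm_apply_eq, h.diamond_rot_left hw hc (by simpa using ha) (h.left.adj_rot_symm hwa)]
      simp
  turn_right w a ε hw ha hc hwa := by
    rcases Int.units_eq_one_or ε with rfl | rfl
    · simp only [turn_one] at hc ⊢
      exact h.diamond_rot_right hw ha hc hwa
    · simp only [turn_neg_one] at hc ⊢
      rw [Equiv.symm_apply_eq,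
        h.diamond_rot_right hw hc (by simpa using ha) (h.right.adj_rot_symm hwa)]
      simp
  turn_left_right w a ε hw hwa hc := by
    rcases Int.units_eq_one_or ε with rfl | rfl
    · simp only [turn_one] at hc ⊢
      exact h.diamond_rot_left_right hw hwa hc
    · simp only [turn_neg_one] at hc ⊢
      have hx : G₂.Adj w x₀ := ((h.adj_iff w).2 (hc ▸ h.left.adj_rot_symm hwa).symm).symm
      rw [Equiv.symm_apply_eq, h.diamond_rot_right_left hw (h.right.adj_rot_symm hx) (by simp)]
      rw [Equiv.symm_apply_eq] at hc
      exact hc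
  turn_right_left w a ε hw hwa hc := by
    rcases Int.units_eq_one_or ε with rfl | rfl
    · simp only [turn_one] at hc ⊢
      exact h.diamond_rot_right_left hw hwa hc
    · simp only [turn_neg_one] at hc ⊢
      have hx : G₁.Adj w x₀ := ((h.adj_iff w).1 (hc ▸ h.right.adj_rot_symm hwa).symm).symm
      rw [Equiv.symm_apply_eq, h.diamond_rot_left_right hw (h.left.adj_rot_symm hx) (by simp)]
      rw [Equiv.symm_apply_eq] at hc
      exact hc
  sgn_left w x _ _ hwx := by simp [diamond, hwx]
  sgn_right w x hw hx hwx := by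
    have : ¬ G₁.Adj w x := fun h' => h.disjoint w x hw hx h' hwx
    simp [diamond, this]

/-- Following the rotation of the first summand from `z` until `x₀` comes up amounts to following the
rotation of the sum from `z` until the neighbours in the first summand are exhausted. -/
lemma exists_pow_to_right (hD : D.Merges R₁ R₂ G₁ G₂ x₀) (h : R₁.IsQuadrangulation G₁) {w : X}
    (hw : w ≠ x₀) (i : ℕ) : ∀ z, G₁.Adj w z → z ≠ x₀ → (R₁.rot w ^ i) z = x₀ →
      ∃ j : ℕ, (D.rot w ^ j) z = R₂.rot w x₀ := by
  induction i with
  | zero => exact fun z _ hz h' => absurd h' (by simpa using hz)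
  | succ i ih =>
    intro z hwz hz h'
    rw [pow_succ, Equiv.Perm.mul_apply] at h'
    by_cases hx : R₁.rot w z = x₀
    · exact ⟨1, by simpa using hD.turn_left_right w z 1 hw hwz (by simpa using hx)⟩
    · obtain ⟨j, hj⟩ := ih _ (h.adj_rot hwz) hx h'
      have := hD.turn_left w z 1 hw hz (by simpa using hx) hwz
      rw [turn_one, turn_one] at this
      exact ⟨j + 1, by rw [pow_succ, Equiv.Perm.mul_apply, this, hj]⟩

/-- The rotation of the sum reaches every neighbour in the first summand from the first one
after `x₀`. -/
lemma exists_pow_from_left (hD : D.Merges R₁ R₂ G₁ G₂ x₀) (h : R₁.IsQuadrangulation G₁) {w : X}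
    (hw : w ≠ x₀) (hwx : G₁.Adj w x₀) (i : ℕ) :
    (R₁.rot w ^ i) x₀ = x₀ ∨ (G₁.Adj w ((R₁.rot w ^ i) x₀) ∧
      ∃ j : ℕ, (D.rot w ^ j) (R₁.rot w x₀) = (R₁.rot w ^ i) x₀) := by
  induction i with
  | zero => simp
  | succ i ih =>
    rw [pow_succ', Equiv.Perm.mul_apply]
    by_cases hi : (R₁.rot w ^ i) x₀ = x₀
    · rw [hi]
      exact Or.inr ⟨h.adj_rot hwx, 0, rfl⟩
    · obtain ⟨hadj, j, hj⟩ := ih.resolve_left hi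
      by_cases hx : R₁.rot w ((R₁.rot w ^ i) x₀) = x₀
      · exact Or.inl hx
      · have := hD.turn_left w _ 1 hw hi (by simpa using hx) hadj
        rw [turn_one, turn_one] at this
        exact Or.inr ⟨h.adj_rot hadj, j + 1, by rw [pow_succ', Equiv.Perm.mul_apply, hj, this]⟩

lemma exists_pow_left_right (h : Summable R₁ R₂ G₁ G₂ x₀) (hD : D.Merges R₁ R₂ G₁ G₂ x₀) {w x y : X}
    (hw : w ≠ x₀) (hx : x ≠ x₀) (hy : y ≠ x₀) (hwx : G₁.Adj w x) (hwy : G₂.Adj w y) :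
    ∃ i : ℕ, (D.rot w ^ i) x = y := by
  have hwx₀ := h.adj_of_adj w x y hw hwx hwy
  have hwx₀' : G₂.Adj w x₀ := ((h.adj_iff w).2 hwx₀.symm).symm
  obtain ⟨i, hi⟩ := h.left.cyclic w x x₀ hwx hwx₀
  obtain ⟨j, hj⟩ := exists_pow_to_right hD h.left hw i x hwx hx hi
  obtain ⟨k, hk⟩ := h.right.cyclic w x₀ y hwx₀' hwy
  rcases exists_pow_from_left hD.swap h.right hw hwx₀' k with h' | ⟨-, l, hl⟩
  · exact absurd (hk.symm.trans h') hy
  · exact ⟨l + j, by rw [pow_add, Equiv.Perm.mul_apply, hj, hl, hk]⟩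

lemma exists_pow_left_left (h : Summable R₁ R₂ G₁ G₂ x₀) (hD : D.Merges R₁ R₂ G₁ G₂ x₀) {w x y : X}
    (hw : w ≠ x₀) (hx : x ≠ x₀) (hy : y ≠ x₀) (hwx : G₁.Adj w x) (hwy : G₁.Adj w y) :
    ∃ i : ℕ, (D.rot w ^ i) x = y := by
  by_cases hwx₀ : G₁.Adj w x₀
  · -- Pass through the neighbours of `w` in the second summand.
    have hwx₀' : G₂.Adj w x₀ := ((h.adj_iff w).2 hwx₀.symm).symm
    have hz : R₂.rot w x₀ ≠ x₀ := (h.right.rot_ne_iff w x₀).2 hwx₀'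
    obtain ⟨i, hi⟩ := h.exists_pow_left_right hD hw hx hz hwx (h.right.adj_rot hwx₀')
    obtain ⟨j, hj⟩ := h.swap.exists_pow_left_right hD.swap hw hz hy (h.right.adj_rot hwx₀') hwy
    exact ⟨j + i, by rw [pow_add, Equiv.Perm.mul_apply, hi, hj]⟩
  · obtain ⟨i, rfl⟩ := h.left.cyclic w x y hwx hwy
    clear hy hwy
    refine ⟨i, And.right (a := G₁.Adj w ((R₁.rot w ^ i) x)) ?_⟩
    induction i with
    | zero => exact ⟨hwx, rfl⟩
    | succ i ih =>
      simp only [pow_succ', Equiv.Perm.mul_apply, ih.2]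
      have hadj := h.left.adj_rot ih.1
      refine ⟨hadj, ?_⟩
      have := hD.turn_left w _ 1 hw (fun h' => hwx₀ (h' ▸ ih.1))
        (by rw [turn_one]; exact fun h' => hwx₀ (h' ▸ hadj)) ih.1
      simpa using this

/-- The diamond sum of two quadrangulations is a quadrangulation. -/
theorem isQuadrangulation (h : Summable R₁ R₂ G₁ G₂ x₀) :
    (diamond R₁ R₂ G₁ x₀).IsQuadrangulation (diamondGraph G₁ G₂ x₀) where
  rot_ne_iff w x := by
    have hm := h.merges
    by_cases hw : w = x₀
    · simp [diamond, diamondGraph, hw]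
    by_cases hx : x = x₀
    · simp [diamond, diamondGraph, hw, hx]
    constructor
    · contrapose
      intro h'
      have h₁ : ¬ G₁.Adj w x := fun h₁ => h' ⟨Or.inl h₁, hw, hx⟩
      have h₂ : ¬ G₂.Adj w x := fun h₂ => h' ⟨Or.inr h₂, hw, hx⟩
      classical
      simp only [diamond, if_neg hw, Equiv.Perm.mul_apply, h.right.rot_eq_of_not_adj h₂,
        h.left.rot_eq_of_not_adj h₁]
      refine Equiv.swap_apply_of_ne_of_ne hx fun h'' => hx ?_
      rw [← h.left.rot_eq_of_not_adj h₁] at h''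
      have := (R₁.rot w).injective h''
      rw [← h.right.rot_eq_of_not_adj h₂] at this
      exact (R₂.rot w).injective this
    · rintro ⟨h₁ | h₂, -, -⟩
      · by_cases hc : R₁.rot w x = x₀
        · have := h.diamond_rot_left_right hw h₁ hc
          rw [this]
          intro h'
          have hwx : G₂.Adj w x₀ := ((h.adj_iff w).2 (hc ▸ h.left.adj_rot h₁).symm).symm
          exact h.disjoint w x hw hx h₁ (h' ▸ h.right.adj_rot hwx)
        · rw [h.diamond_rot_left hw hx hc h₁]
          exact (h.left.rot_ne_iff w x).2 h₁
      · by_cases hc : R₂.rot w x = x₀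
        · have := h.diamond_rot_right_left hw h₂ hc
          rw [this]
          intro h'
          have hwx : G₁.Adj w x₀ := ((h.adj_iff w).1 (hc ▸ h.right.adj_rot h₂).symm).symm
          exact h.disjoint w x hw hx (h' ▸ h.left.adj_rot hwx) h₂
        · rw [h.diamond_rot_right hw hx hc h₂]
          exact (h.right.rot_ne_iff w x).2 h₂
  cyclic := by
    rintro w x y ⟨hx | hx, hw, hx₀⟩ ⟨hy | hy, -, hy₀⟩
    · exact h.exists_pow_left_left h.merges hw hx₀ hy₀ hx hy
    · exact h.exists_pow_left_right h.merges hw hx₀ hy₀ hx hy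
    · exact h.swap.exists_pow_left_right h.merges.swap hw hx₀ hy₀ hx hy
    · exact h.swap.exists_pow_left_left h.merges.swap hw hx₀ hy₀ hx hy
  sgn_symm w x := by
    by_cases hwx : G₁.Adj w x
    · simp [diamond, hwx, hwx.symm, h.left.sgn_symm w x]
    · have : ¬ G₁.Adj x w := fun h' => hwx h'.symm
      simp [diamond, hwx, this, h.right.sgn_symm w x]
  face := by
    rintro a b ⟨hab | hab, ha, hb⟩ ε
    · exact h.exists_isFace h.merges hab ha hb ε
    · exact h.swap.exists_isFace h.merges.swap hab ha hb ε

end Summable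

end RotationSystem

/-! ### Relabelling and switching -/

namespace RotationSystem

variable {X Y : Type*} {R : RotationSystem X} {G : SimpleGraph X}

/-- A quadrangulation can be relabelled along a map that is injective on the non-isolated vertices,
into a larger or a smaller vertex type. -/
theorem IsQuadrangulation.exists_relabel [Nonempty X] (h : R.IsQuadrangulation G) {f : X → Y}
    {G' : SimpleGraph Y} (hf : Set.InjOn f G.support)
    (hG' : ∀ y y', G'.Adj y y' ↔ ∃ x x', G.Adj x x' ∧ f x = y ∧ f x' = y') :
    ∃ R' : RotationSystem Y, R'.IsQuadrangulation G' ∧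
      (∀ x x', G.Adj x x' → R'.rot (f x) (f x') = f (R.rot x x')) ∧
      ∀ x x', G.Adj x x' → R'.sgn (f x) (f x') = R.sgn x x' := by
  classical
  have hS : ∀ w x, x ∈ G.support ↔ R.rot w x ∈ G.support := by
    intro w x
    by_cases hx : G.Adj w x
    · exact ⟨fun _ => ⟨w, (h.adj_rot hx).symm⟩, fun _ => ⟨w, hx.symm⟩⟩
    · rw [h.rot_eq_of_not_adj hx]
  let e := Equiv.Set.imageOfInjOn f G.support hf
  let g : Y → X := Function.invFunOn f G.support
  have hg : ∀ x ∈ G.support, g (f x) = x := fun x hx => hf.leftInvOn_invFunOn hx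
  let R' : RotationSystem Y :=
    { rot := fun y => if y ∈ f '' G.support then
        ((R.rot (g y)).subtypePerm fun x => (hS (g y) x).symm).extendDomain e else 1
      sgn := fun y y' => R.sgn (g y) (g y') }
  have hrot : ∀ w x, w ∈ G.support → x ∈ G.support → R'.rot (f w) (f x) = f (R.rot w x) := by
    intro w x hw hx
    have h₁ : f w ∈ f '' G.support := ⟨w, hw, rfl⟩
    simp only [R', if_pos h₁, hg w hw]
    exact Equiv.Perm.extendDomain_apply_image _ e ⟨x, hx⟩
  have hsymm : ∀ w x, w ∈ G.support → x ∈ G.support →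
      (R'.rot (f w)).symm (f x) = f ((R.rot w).symm x) := by
    intro w x hw hx
    rw [Equiv.symm_apply_eq, hrot w _ hw ((hS w _).2 (by simpa using hx)), Equiv.apply_symm_apply]
  have hturn : ∀ w x ε, G.Adj w x → R'.turn (f w) ε (f x) = f (R.turn w ε x) := by
    intro w x ε hwx
    rcases Int.units_eq_one_or ε with rfl | rfl
    · simpa using hrot w x ⟨x, hwx⟩ ⟨w, hwx.symm⟩
    · simpa using hsymm w x ⟨x, hwx⟩ ⟨w, hwx.symm⟩
  have hsgn : ∀ x x', G.Adj x x' → R'.sgn (f x) (f x') = R.sgn x x' := fun x x' hx => by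
    simp only [R', hg x ⟨x', hx⟩, hg x' ⟨x, hx.symm⟩]
  refine ⟨R', ⟨?_, ?_, fun w x => h.sgn_symm _ _, ?_⟩,
    fun x x' hx => hrot x x' ⟨x', hx⟩ ⟨x, hx.symm⟩, hsgn⟩
  · intro w x
    rw [hG']
    constructor
    · intro hne
      by_cases hw : w ∈ f '' G.support
      · by_cases hx : x ∈ f '' G.support
        · obtain ⟨w, hw, rfl⟩ := hw
          obtain ⟨x, hx, rfl⟩ := hx
          rw [hrot w x hw hx] at hne
          exact ⟨w, x, (h.rot_ne_iff w x).1 fun h' => hne (by rw [h']), rfl, rfl⟩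
        · simp only [R', if_pos hw] at hne
          exact absurd (Equiv.Perm.extendDomain_apply_not_subtype _ e hx) hne
      · simp only [R', if_neg hw] at hne
        exact absurd rfl hne
    · rintro ⟨w, x, hwx, rfl, rfl⟩
      rw [hrot w x ⟨x, hwx⟩ ⟨w, hwx.symm⟩]
      intro h'
      exact (h.rot_ne_iff w x).2 hwx (hf ⟨w, (h.adj_rot hwx).symm⟩ ⟨w, hwx.symm⟩ h')
  · intro w x y hx hy
    obtain ⟨w, x, hwx, rfl, rfl⟩ := (hG' _ _).1 hx
    obtain ⟨w', y, hwy, hw, rfl⟩ := (hG' _ _).1 hy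
    obtain rfl := hf ⟨y, hwy⟩ ⟨x, hwx⟩ hw
    obtain ⟨i, rfl⟩ := h.cyclic _ _ _ hwx hwy
    clear hwy hy
    refine ⟨i, And.right (a := G.Adj w' ((R.rot w' ^ i) x)) ?_⟩
    induction i with
    | zero => exact ⟨hwx, rfl⟩
    | succ i ih =>
      simp only [pow_succ', Equiv.Perm.mul_apply, ih.2]
      exact ⟨h.adj_rot ih.1, hrot _ _ ⟨_, hwx⟩ ⟨_, ih.1.symm⟩⟩
  · intro a' b' hab' ε
    obtain ⟨a, b, hab, rfl, rfl⟩ := (hG' _ _).1 hab'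
    obtain ⟨c, d, h₁, h₂, h₃, h₄, h₅⟩ := h.face a b hab ε
    have hbc : G.Adj b c := h₁ ▸ h.adj_turn hab.symm _
    have hcd : G.Adj c d := h₂ ▸ h.adj_turn hbc.symm _
    have hda : G.Adj d a := h₃ ▸ h.adj_turn hcd.symm _
    refine ⟨f c, f d, ?_, ?_, ?_, ?_, ?_⟩
    · rw [hsgn a b hab, hturn b a _ hab.symm, h₁]
    · rw [hsgn a b hab, hsgn b c hbc, hturn c b _ hbc.symm, h₂]
    · rw [hsgn a b hab, hsgn b c hbc, hsgn c d hcd, hturn d c _ hcd.symm, h₃]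
    · rw [hturn a d _ hda.symm, h₄]
    · rw [hsgn a b hab, hsgn b c hbc, hsgn c d hcd, hsgn d a hda, h₅]

/-- Reversal of the local orientation at every vertex `w` with `o w = -1`. -/
def switch (R : RotationSystem X) (o : X → ℤˣ) : RotationSystem X where
  rot w := R.rot w ^ (o w : ℤ)
  sgn w x := o w * R.sgn w x * o x

lemma switch_turn (R : RotationSystem X) (o : X → ℤˣ) (b : X) (ε : ℤˣ) (a : X) :
    (R.switch o).turn b ε a = R.turn b (ε * o b) a := by
  simp only [turn_eq_zpow, switch, ← zpow_mul, mul_comm ε, Units.val_mul]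

theorem IsQuadrangulation.switch (h : R.IsQuadrangulation G) (o : X → ℤˣ) :
    (R.switch o).IsQuadrangulation G where
  rot_ne_iff w x := by
    rw [← h.rot_ne_iff]
    rcases Int.units_eq_one_or (o w) with ho | ho
    · simp [RotationSystem.switch, ho]
    · simp only [RotationSystem.switch, ho, Units.val_neg, Units.val_one, zpow_neg, zpow_one, ne_eq,
        Equiv.Perm.inv_eq_iff_eq]
      rw [eq_comm]
  cyclic w x y hx hy := by
    rcases Int.units_eq_one_or (o w) with ho | ho
    · simpa [RotationSystem.switch, ho] using h.cyclic w x y hx hy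
    · obtain ⟨i, hi⟩ := h.cyclic w y x hy hx
      refine ⟨i, ?_⟩
      simp only [RotationSystem.switch, ho, Units.val_neg, Units.val_one, zpow_neg, zpow_one, inv_pow,
        Equiv.Perm.inv_eq_iff_eq, hi]
  sgn_symm w x := by
    simp only [RotationSystem.switch, h.sgn_symm w x]
    rw [mul_right_comm, mul_comm (o w * o x), mul_comm (o x), mul_assoc, mul_comm (o w)]
  face a b hab ε := by
    obtain ⟨c, d, h₁, h₂, h₃, h₄, h₅⟩ := h.face a b hab (ε * o a)
    have key : ∀ (x : X) (t : ℤˣ), t * o x * o x = t := fun x t => by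
      rw [mul_assoc, Int.units_mul_self, mul_one]
    refine ⟨c, d, ?_, ?_, ?_, ?_, ?_⟩
    · rw [switch_turn]
      simpa only [RotationSystem.switch, ← mul_assoc, key] using h₁
    · rw [switch_turn]
      simpa only [RotationSystem.switch, ← mul_assoc, key] using h₂
    · rw [switch_turn]
      simpa only [RotationSystem.switch, ← mul_assoc, key] using h₃
    · rw [switch_turn, h₄]
    · simp only [RotationSystem.switch, ← mul_assoc, key]
      rw [mul_assoc (o a), mul_assoc (o a), mul_assoc (o a), h₅, mul_one, Int.units_mul_self]

/-- The local orientations can be chosen to agree along every edge at `x₀`, and the product of the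
signs along a triangle does not depend on that choice. -/
lemma IsQuadrangulation.exists_sgn_eq_one (h : R.IsQuadrangulation G) (x₀ : X) :
    ∃ R' : RotationSystem X, R'.IsQuadrangulation G ∧ (∀ x, G.Adj x₀ x → R'.sgn x₀ x = 1) ∧
      ∀ a b c, R'.sgn a b * R'.sgn b c * R'.sgn c a = R.sgn a b * R.sgn b c * R.sgn c a := by
  classical
  refine ⟨R.switch fun x => if x = x₀ then 1 else R.sgn x₀ x, h.switch _, ?_, ?_⟩
  · intro x hx
    simp [RotationSystem.switch, hx.ne', Int.units_mul_self]
  · intro a b c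
    generalize (fun x => if x = x₀ then (1 : ℤˣ) else R.sgn x₀ x) = o
    have key : ∀ (x : X) (t : ℤˣ), t * o x * o x = t := fun x t => by
      rw [mul_assoc, Int.units_mul_self, mul_one]
    simp only [RotationSystem.switch, ← mul_assoc, key]
    rw [mul_assoc (o a), mul_assoc (o a), mul_comm (o a), key]

/-! ### Cycles of equal length -/

open Function in
lemma ncard_eq_minimalPeriod {f : X → X} {x₀ : X} {N : Set X} (hN : ∀ x, x ∈ N ↔ ∃ i, f^[i] x₀ = x)
    (hp : x₀ ∈ periodicPts f) : N.ncard = minimalPeriod f x₀ := by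
  have : N = (fun i => f^[i] x₀) '' Set.Iio (minimalPeriod f x₀) := by
    ext x
    rw [hN]
    constructor
    · rintro ⟨i, rfl⟩
      exact ⟨i % minimalPeriod f x₀, Nat.mod_lt _ (minimalPeriod_pos_of_mem_periodicPts hp),
        iterate_mod_minimalPeriod_eq⟩
    · rintro ⟨i, -, rfl⟩
      exact ⟨i, rfl⟩
  rw [this, Set.InjOn.ncard_image iterate_injOn_Iio_minimalPeriod, ← Finset.coe_Iio,
    Set.ncard_coe_finset, Nat.card_Iio]

open Function in
lemma iterate_eq_of_minimalPeriod_eq {f : X → X} {g : Y → Y} {x₀ : X} {y₀ : Y}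
    (hp : x₀ ∈ periodicPts f) (h : minimalPeriod f x₀ = minimalPeriod g y₀) {i j : ℕ}
    (hij : f^[i] x₀ = f^[j] x₀) : g^[i] y₀ = g^[j] y₀ := by
  have hpos := minimalPeriod_pos_of_mem_periodicPts hp
  rw [← iterate_mod_minimalPeriod_eq (n := i), ← iterate_mod_minimalPeriod_eq (n := j)] at hij
  have := iterate_injOn_Iio_minimalPeriod (Nat.mod_lt _ hpos) (Nat.mod_lt _ hpos) hij
  rw [← iterate_mod_minimalPeriod_eq (n := i), ← iterate_mod_minimalPeriod_eq (n := j), ← h, this]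

open Function in
/-- Two cycles of the same length are conjugate. -/
lemma exists_bijOn_semiconj {f : X → X} {g : Y → Y} {x₀ : X} {y₀ : Y} {N : Set X} {N' : Set Y}
    (hN : ∀ x, x ∈ N ↔ ∃ i, f^[i] x₀ = x) (hN' : ∀ y, y ∈ N' ↔ ∃ i, g^[i] y₀ = y)
    (hp : x₀ ∈ periodicPts f) (hp' : y₀ ∈ periodicPts g) (hcard : N.ncard = N'.ncard) :
    ∃ F : X → Y, Set.BijOn F N N' ∧ ∀ x ∈ N, F (f x) = g (F x) := by
  classical
  rw [ncard_eq_minimalPeriod hN hp, ncard_eq_minimalPeriod hN' hp'] at hcard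
  let F : X → Y := fun x => if h : ∃ i, f^[i] x₀ = x then g^[h.choose] y₀ else y₀
  have hF : ∀ i, F (f^[i] x₀) = g^[i] y₀ := by
    intro i
    have h : ∃ j, f^[j] x₀ = f^[i] x₀ := ⟨i, rfl⟩
    simp only [F, dif_pos h]
    exact iterate_eq_of_minimalPeriod_eq hp hcard h.choose_spec
  refine ⟨F, ⟨?_, ?_, ?_⟩, ?_⟩
  · intro x hx
    obtain ⟨i, rfl⟩ := (hN x).1 hx
    exact (hN' _).2 ⟨i, (hF i).symm⟩
  · intro x hx y hy hxy
    obtain ⟨i, rfl⟩ := (hN x).1 hx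
    obtain ⟨j, rfl⟩ := (hN y).1 hy
    rw [hF, hF] at hxy
    exact iterate_eq_of_minimalPeriod_eq hp' hcard.symm hxy
  · intro y hy
    obtain ⟨i, rfl⟩ := (hN' y).1 hy
    exact ⟨f^[i] x₀, (hN _).2 ⟨i, rfl⟩, hF i⟩
  · intro x hx
    obtain ⟨i, rfl⟩ := (hN x).1 hx
    rw [hF, ← iterate_succ_apply' f, ← iterate_succ_apply' g, hF]

lemma IsQuadrangulation.mem_neighborSet_iff (h : R.IsQuadrangulation G) {w x₀ : X}
    (hx₀ : G.Adj w x₀) (x : X) : x ∈ G.neighborSet w ↔ ∃ i, (R.rot w)^[i] x₀ = x := by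
  simp only [Equiv.Perm.iterate_eq_pow, SimpleGraph.mem_neighborSet]
  constructor
  · exact fun hx => h.cyclic w x₀ x hx₀ hx
  · rintro ⟨i, rfl⟩
    induction i with
    | zero => exact hx₀
    | succ i ih => rw [pow_succ', Equiv.Perm.mul_apply]; exact h.adj_rot ih

lemma IsQuadrangulation.mem_periodicPts (h : R.IsQuadrangulation G) {w x₀ : X} (hx₀ : G.Adj w x₀) :
    x₀ ∈ Function.periodicPts (R.rot w) := by
  obtain ⟨i, hi⟩ := h.cyclic w (R.rot w x₀) x₀ (h.adj_rot hx₀) hx₀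
  refine ⟨i + 1, Nat.succ_pos i, ?_⟩
  rw [Function.IsPeriodicPt, Function.IsFixedPt, Equiv.Perm.iterate_eq_pow, pow_succ,
    Equiv.Perm.mul_apply, hi]

/-- Neighbourhoods of the same size can be identified in such a way that the rotations become
inverse to each other. -/
lemma IsQuadrangulation.exists_bijOn_neighborSet {R' : RotationSystem Y} {G' : SimpleGraph Y}
    (h : R.IsQuadrangulation G) (h' : R'.IsQuadrangulation G') {w : X} {w' : Y}
    (hcard : (G.neighborSet w).ncard = (G'.neighborSet w').ncard)
    (hne : (G.neighborSet w).ncard ≠ 0) :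
    ∃ F : X → Y, Set.BijOn F (G.neighborSet w) (G'.neighborSet w') ∧
      ∀ x, G.Adj w x → F (R.rot w x) = (R'.rot w').symm (F x) := by
  obtain ⟨x₀, hx₀⟩ := Set.nonempty_of_ncard_ne_zero hne
  obtain ⟨y₀, hy₀⟩ := Set.nonempty_of_ncard_ne_zero (hcard ▸ hne)
  -- Switching everywhere inverts all rotations.
  have h'' := h'.switch fun _ => -1
  have e : (R'.switch fun _ => -1).rot w' = (R'.rot w').symm := by
    simp [RotationSystem.switch, Equiv.Perm.inv_def]
  have hN := h''.mem_neighborSet_iff hy₀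
  have hp := h''.mem_periodicPts hy₀
  rw [e] at hN hp
  exact exists_bijOn_semiconj (h.mem_neighborSet_iff hx₀) hN (h.mem_periodicPts hx₀) hp hcard

end RotationSystem

/-! ### Rotation systems and cellular embeddings -/

namespace RotationSystem

variable {V : Type*} {G : SimpleGraph V} {R : RotationSystem V} {Φ : CellularEmbedding G}

/-- The cellular embedding `Φ` has the rotations and signs given by `R`. -/
structure Represents (R : RotationSystem V) (Φ : CellularEmbedding G) : Prop where
  snd_rot : ∀ d : G.Dart, (Φ.rot d).snd = R.rot d.fst d.snd
  dartSign_eq : ∀ d : G.Dart, Φ.dartSign d = R.sgn d.fst d.snd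

lemma fst_symm_rot (Φ : CellularEmbedding G) (d : G.Dart) : (Φ.rot.symm d).fst = d.fst := by
  rw [← Φ.rot_fst, Equiv.apply_symm_apply]

namespace Represents

lemma fst_zpow (Φ : CellularEmbedding G) (ε : ℤˣ) (d : G.Dart) :
    ((Φ.rot ^ (ε : ℤ)) d).fst = d.fst := by
  rcases Int.units_eq_one_or ε with rfl | rfl
  · simpa using Φ.rot_fst d
  · simpa using fst_symm_rot Φ d

lemma snd_zpow (h : R.Represents Φ) (ε : ℤˣ) (d : G.Dart) :
    ((Φ.rot ^ (ε : ℤ)) d).snd = R.turn d.fst ε d.snd := by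
  rcases Int.units_eq_one_or ε with rfl | rfl
  · simpa using h.snd_rot d
  · have := h.snd_rot (Φ.rot.symm d)
    rw [Equiv.apply_symm_apply, fst_symm_rot] at this
    simp [this, Equiv.Perm.inv_def]

lemma fst_faceStep (x : G.Dart × ℤˣ) : (Φ.faceStep x).1.fst = x.1.snd := fst_zpow _ _ _

lemma snd_faceStep (h : R.Represents Φ) (x : G.Dart × ℤˣ) :
    (Φ.faceStep x).1.snd = R.turn x.1.snd (x.2 * R.sgn x.1.fst x.1.snd) x.1.fst := by
  rw [← h.dartSign_eq]
  exact h.snd_zpow _ _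

lemma sign_faceStep (h : R.Represents Φ) (x : G.Dart × ℤˣ) :
    (Φ.faceStep x).2 = x.2 * R.sgn x.1.fst x.1.snd := by
  rw [← h.dartSign_eq]
  rfl

lemma faceStep_iterate_four_eq_iff (h : R.Represents Φ) (x : G.Dart × ℤˣ) :
    Φ.faceStep^[4] x = x ↔ ∃ c d, R.IsFace x.1.fst x.1.snd c d x.2 := by
  have ext_iff : ∀ y : G.Dart × ℤˣ, y = x ↔
      y.1.fst = x.1.fst ∧ y.1.snd = x.1.snd ∧ y.2 = x.2 := by
    intro y
    rw [Prod.ext_iff, SimpleGraph.Dart.ext_iff, Prod.ext_iff, and_assoc]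
  simp only [ext_iff, Function.iterate_succ, Function.iterate_zero, Function.comp_apply, id_eq,
    h.snd_faceStep, h.sign_faceStep, fst_faceStep, IsFace]
  constructor
  · rintro ⟨h₁, h₂, h₃⟩
    rw [h₃, h₁] at h₂
    rw [h₁, mul_assoc, mul_assoc, mul_assoc, mul_eq_left, ← mul_assoc, ← mul_assoc] at h₃
    exact ⟨_, _, rfl, rfl, h₁, h₂, h₃⟩
  · rintro ⟨c, d, rfl, rfl, h₃, h₄, h₅⟩
    rw [h₃]
    have := congrArg (x.2 * ·) h₅
    simp only [← mul_assoc, mul_one] at this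
    rw [this]
    exact ⟨rfl, h₄, rfl⟩

end Represents

open Classical in
/-- The rotation system of a cellular embedding. -/
noncomputable def ofEmbedding (Φ : CellularEmbedding G) : RotationSystem V where
  rot w :=
    { toFun := fun x => if h : G.Adj w x then (Φ.rot ⟨(w, x), h⟩).snd else x
      invFun := fun x => if h : G.Adj w x then (Φ.rot.symm ⟨(w, x), h⟩).snd else x
      left_inv := by
        intro x
        by_cases h : G.Adj w x
        · have h₁ : (Φ.rot ⟨(w, x), h⟩).fst = w := Φ.rot_fst _
          have h₂ : G.Adj w (Φ.rot ⟨(w, x), h⟩).snd := by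
            simpa only [h₁] using (Φ.rot ⟨(w, x), h⟩).adj
          have : (⟨(w, (Φ.rot ⟨(w, x), h⟩).snd), h₂⟩ : G.Dart) = Φ.rot ⟨(w, x), h⟩ :=
            SimpleGraph.Dart.ext _ _ (Prod.ext h₁.symm rfl)
          simp [h, h₂, this]
        · simp [h]
      right_inv := by
        intro x
        by_cases h : G.Adj w x
        · have h₁ : (Φ.rot.symm ⟨(w, x), h⟩).fst = w := fst_symm_rot Φ _
          have h₂ : G.Adj w (Φ.rot.symm ⟨(w, x), h⟩).snd := by
            simpa only [h₁] using (Φ.rot.symm ⟨(w, x), h⟩).adj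
          have : (⟨(w, (Φ.rot.symm ⟨(w, x), h⟩).snd), h₂⟩ : G.Dart) = Φ.rot.symm ⟨(w, x), h⟩ :=
            SimpleGraph.Dart.ext _ _ (Prod.ext h₁.symm rfl)
          simp [h, h₂, this]
        · simp [h] }
  sgn w x := if h : G.Adj w x then Φ.dartSign ⟨(w, x), h⟩ else 1

lemma represents_ofEmbedding (Φ : CellularEmbedding G) : (ofEmbedding Φ).Represents Φ where
  snd_rot d := by
    have : G.Adj d.fst d.snd := d.adj
    simp [ofEmbedding]
  dartSign_eq d := by
    have : G.Adj d.fst d.snd := d.adj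
    simp [ofEmbedding]

theorem isQuadrangulation_ofEmbedding [Finite V] (hΦ : Φ.IsQuadrangular) :
    (ofEmbedding Φ).IsQuadrangulation G where
  rot_ne_iff w x := by
    constructor
    · intro h
      by_contra hwx
      exact h (by simp [ofEmbedding, hwx])
    · -- A vertex of degree one would be passed by a facial walk `x, w, x`.
      intro hwx hfix
      have hr := represents_ofEmbedding Φ
      have hinj := (hΦ.2 (⟨(x, w), hwx.symm⟩, 1)).2
      have h02 : (0 : Fin 4) = 2 := by
        apply hinj
        simp only [Fin.val_zero, Function.iterate_zero, id_eq, Fin.val_two, Function.iterate_succ,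
          Function.comp_apply, Represents.fst_faceStep, hr.snd_faceStep]
        generalize 1 * (ofEmbedding Φ).sgn x w = ε
        rcases Int.units_eq_one_or ε with rfl | rfl
        · rw [turn_one, hfix]
        · rw [turn_neg_one, eq_comm, Equiv.symm_apply_eq, hfix]
      exact absurd h02 (by decide)
  cyclic w x y hx hy := by
    have : Finite G.Dart := Finite.of_injective _ SimpleGraph.Dart.toProd_injective
    obtain ⟨i, hi⟩ := (Φ.rot_sameCycle ⟨(w, x), hx⟩ ⟨(w, y), hy⟩ rfl).exists_nat_pow_eq
    refine ⟨i, ?_⟩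
    have : ∀ j : ℕ, ((Φ.rot ^ j) ⟨(w, x), hx⟩).fst = w ∧
        ((Φ.rot ^ j) ⟨(w, x), hx⟩).snd = ((ofEmbedding Φ).rot w ^ j) x := by
      intro j
      induction j with
      | zero => simp
      | succ j ih =>
        simp only [pow_succ', Equiv.Perm.mul_apply]
        rw [Φ.rot_fst, (represents_ofEmbedding Φ).snd_rot, ih.1, ih.2]
        exact ⟨rfl, rfl⟩
    rw [← (this i).2, hi]
  sgn_symm w x := by
    by_cases h : G.Adj w x
    · simp only [ofEmbedding, dif_pos h, dif_pos h.symm]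
      exact congrArg Φ.sign (Subtype.ext Sym2.eq_swap)
    · have h' : ¬ G.Adj x w := fun h' => h h'.symm
      simp [ofEmbedding, h, h']
  face a b hab ε :=
    ((represents_ofEmbedding Φ).faceStep_iterate_four_eq_iff (⟨(a, b), hab⟩, ε)).1
      (hΦ.2 (⟨(a, b), hab⟩, ε)).1

/-- The cellular embedding described by a quadrangulation. -/
def IsQuadrangulation.toEmbedding (h : R.IsQuadrangulation G) : CellularEmbedding G where
  rot :=
    { toFun := fun d => ⟨(d.fst, R.rot d.fst d.snd), h.adj_rot d.adj⟩
      invFun := fun d => ⟨(d.fst, (R.rot d.fst).symm d.snd), h.adj_rot_symm d.adj⟩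
      left_inv := fun d => by ext <;> simp
      right_inv := fun d => by ext <;> simp }
  rot_fst _ := rfl
  rot_sameCycle := by
    rintro ⟨⟨w, x⟩, hx⟩ ⟨⟨w', y⟩, hy⟩ (rfl : w = w')
    obtain ⟨i, rfl⟩ := h.cyclic w x y hx hy
    refine ⟨i, ?_⟩
    rw [zpow_natCast]
    induction i with
    | zero => rfl
    | succ i ih =>
      have hi : G.Adj w ((R.rot w ^ i) x) := by
        have := (h.mem_neighborSet_iff hx ((R.rot w ^ i) x)).2 ⟨i, by
          rw [Equiv.Perm.iterate_eq_pow]⟩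
        exact this
      rw [pow_succ', Equiv.Perm.mul_apply, ih hi]
      ext
      · rfl
      · simp [pow_succ']
  sign e := Sym2.lift ⟨R.sgn, h.sgn_symm⟩ e.1

lemma IsQuadrangulation.represents (h : R.IsQuadrangulation G) : R.Represents h.toEmbedding :=
  ⟨fun _ => rfl, fun _ => rfl⟩

/-- A quadrangulation without isolated vertices that has a triangle along which the orientation is
reversed is a nonorientable quadrangular embedding. -/
theorem IsQuadrangulation.hasNonorientableQuadrangularEmbedding (h : R.IsQuadrangulation G)
    (hG : ∀ v, ∃ w, G.Adj v w) {a b c : V} (hab : G.Adj a b) (hbc : G.Adj b c) (hca : G.Adj c a)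
    (habc : R.sgn a b * R.sgn b c * R.sgn c a = -1) : HasNonorientableQuadrangularEmbedding G := by
  have hr := h.represents
  refine ⟨h.toEmbedding, ⟨hG, fun x => ⟨?_, ?_⟩⟩, ?_⟩
  · exact (hr.faceStep_iterate_four_eq_iff x).2 (h.face _ _ x.1.adj _)
  · -- Consecutive vertices are adjacent, and opposite ones differ because every rotation moves
    -- every neighbour.
    obtain ⟨p, q, h₁, h₂, h₃, h₄, -⟩ := h.face _ _ x.1.adj x.2
    have hbp : G.Adj x.1.snd p := h₁ ▸ h.adj_turn x.1.adj.symm _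
    have hpq : G.Adj p q := h₂ ▸ h.adj_turn hbp.symm _
    have hqa : G.Adj q x.1.fst := h₃ ▸ h.adj_turn hpq.symm _
    have hpa : p ≠ x.1.fst := h₁ ▸ h.turn_ne x.1.adj.symm _
    have hqb : q ≠ x.1.snd := h₂ ▸ h.turn_ne hbp.symm _
    have hf : (fun i : Fin 4 => (h.toEmbedding.faceStep^[(i : ℕ)] x).1.fst) =
        ![x.1.fst, x.1.snd, p, q] := by
      funext i
      fin_cases i
      · rfl
      · exact Represents.fst_faceStep x
      · simp [Represents.fst_faceStep, hr.snd_faceStep, h₁]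
      · simp [Represents.fst_faceStep, hr.snd_faceStep, hr.sign_faceStep, h₁, h₂]
    rw [hf]
    have := x.1.adj.ne
    intro i j hij
    fin_cases i <;> fin_cases j <;> simp_all [hbp.ne, hbp.ne', hpq.ne, hpq.ne', hqa.ne, hqa.ne']
  · rintro ⟨o, ho⟩
    have e₁ := ho ⟨(a, b), hab⟩
    have e₂ := ho ⟨(b, c), hbc⟩
    have e₃ := ho ⟨(c, a), hca⟩
    rw [hr.dartSign_eq] at e₁ e₂ e₃
    simp only at e₁ e₂ e₃
    have : R.sgn a b * R.sgn b c * R.sgn c a = 1 := by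
      have key : ∀ p q r s t u : ℤˣ,
          p * s * q = 1 → q * t * r = 1 → r * u * p = 1 → s * t * u = 1 := by decide
      exact key _ _ _ _ _ _ e₁ e₂ e₃
    rw [this] at habc
    exact absurd habc (by decide)

end RotationSystem

/-! ### Small quadrangulations -/

namespace RotationSystem

instance {X : Type*} [DecidableEq X] (R : RotationSystem X) (a b c d : X) (ε : ℤˣ) :
    Decidable (R.IsFace a b c d ε) := by
  unfold IsFace
  infer_instance

/-- The rotation system on `Fin N` whose rotation at `w` is the cyclic order of the list `L w`, and in
which exactly the edges listed in `neg` have sign `-1`. -/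
def ofLists {N : ℕ} (L : Fin N → List (Fin N)) (neg : List (Fin N × Fin N)) :
    RotationSystem (Fin N) where
  rot w := (L w).formPerm
  sgn a b := if (a, b) ∈ neg ∨ (b, a) ∈ neg then -1 else 1

lemma isQuadrangulation_ofLists {N : ℕ} {L : Fin N → List (Fin N)} {neg : List (Fin N × Fin N)}
    {G : SimpleGraph (Fin N)} (hL : ∀ w, (L w).Nodup ∧ 2 ≤ (L w).length)
    (hG : ∀ w x, G.Adj w x ↔ x ∈ L w)
    (hface : ∀ a, ∀ b ∈ L a, ∀ ε : ℤˣ,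
      let R := ofLists L neg
      let c := R.turn b (ε * R.sgn a b) a
      R.IsFace a b c (R.turn c (ε * R.sgn a b * R.sgn b c) b) ε) :
    (ofLists L neg).IsQuadrangulation G := by
  have hne : ∀ w x, (ofLists L neg).rot w x ≠ x ↔ G.Adj w x := by
    intro w x
    rw [hG]
    constructor
    · exact fun h => List.mem_of_formPerm_apply_ne h
    · exact fun h => (List.formPerm_apply_mem_ne_self_iff _ (hL w).1 _ h).2 (hL w).2
  refine ⟨hne, ?_, ?_, ?_⟩
  · intro w x y hx hy
    rw [← hne] at hx hy
    exact ((List.isCycle_formPerm (hL w).1 (hL w).2).sameCycle hx hy).exists_nat_pow_eq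
  · intro w x
    simp only [ofLists, or_comm]
  · intro a b hab ε
    exact ⟨_, _, hface a b ((hG a b).1 hab) ε⟩

/-- The join of the independent set `S` with a graph `H` on six further vertices. -/
def joinGraph (S : Set ℕ) (H : SimpleGraph (Fin 6)) : SimpleGraph (ℕ ⊕ Fin 6) where
  Adj
    | .inl _, .inl _ => False
    | .inl i, .inr _ => i ∈ S
    | .inr _, .inl i => i ∈ S
    | .inr p, .inr q => H.Adj p q
  symm := ⟨by rintro (i | p) (j | q) h <;> first | exact h | exact SimpleGraph.Adj.symm h⟩
  loopless := ⟨by rintro (i | p) h; exacts [h, H.irrefl h]⟩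

/-- The complete graph on `1, …, 5`, together with the isolated vertex `0`. -/
def fiveGraph : SimpleGraph (Fin 6) where
  Adj p q := p ≠ q ∧ p ≠ 0 ∧ q ≠ 0
  symm := ⟨fun _ _ h => ⟨h.1.symm, h.2.2, h.2.1⟩⟩
  loopless := ⟨fun _ h => h.1 rfl⟩

instance : DecidableRel fiveGraph.Adj := fun p q =>
  inferInstanceAs (Decidable (p ≠ q ∧ p ≠ 0 ∧ q ≠ 0))

lemma fiveGraph_adj (p q : Fin 6) :
    fiveGraph.Adj p q ↔ p.1 ≠ q.1 ∧ p.1 ≠ 0 ∧ q.1 ≠ 0 := by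
  revert p q
  decide

/-- The join of an independent set of size `hi - lo` with `fiveGraph` has a quadrangulation in which
the triangle `1, 4, 5` reverses the orientation. -/
def HasJoinQuadrangulation (lo hi : ℕ) : Prop :=
  ∃ R : RotationSystem (ℕ ⊕ Fin 6), R.IsQuadrangulation (joinGraph (Set.Ico lo hi) fiveGraph) ∧
    R.sgn (.inr 1) (.inr 4) * R.sgn (.inr 4) (.inr 5) * R.sgn (.inr 5) (.inr 1) = -1

/-- The vertices of a graph on `Fin N` as vertices of a join: the first six are those of `fiveGraph`,
the others form the independent set. -/
def toJoin {N : ℕ} (x : Fin N) : ℕ ⊕ Fin 6 :=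
  if h : x.1 < 6 then .inr ⟨x.1, h⟩ else .inl (x.1 - 6)

lemma toJoin_injective {N : ℕ} : Function.Injective (toJoin (N := N)) := by
  intro x y h
  unfold toJoin at h
  ext
  split_ifs at h with h₁ h₂ h₂
  · simpa using h
  · have := Sum.inl.inj h
    omega

lemma exists_toJoin {k : ℕ} {y y' : ℕ ⊕ Fin 6}
    (h : (joinGraph (Set.Ico 0 k) fiveGraph).Adj y y') : ∃ x : Fin (k + 6), toJoin x = y := by
  rcases y with i | p
  · rcases y' with j | q
    · exact h.elim
    · have hi : i < k := h.2
      exact ⟨⟨i + 6, by omega⟩, by simp [toJoin]⟩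
  · exact ⟨⟨p.1, by omega⟩, by simp [toJoin]⟩

lemma hasJoinQuadrangulation_of_lists {k : ℕ} {L : Fin (k + 6) → List (Fin (k + 6))}
    {neg : List (Fin (k + 6) × Fin (k + 6))} (hL : ∀ w, (L w).Nodup ∧ 2 ≤ (L w).length)
    (hG : ∀ w x : Fin (k + 6), x ∈ L w ↔ (if 6 ≤ w.1 then x.1 < 6
      else 6 ≤ x.1 ∨ (w.1 ≠ x.1 ∧ w.1 ≠ 0 ∧ x.1 ≠ 0)))
    (hface : ∀ a, ∀ b ∈ L a, ∀ ε : ℤˣ,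
      let R := ofLists L neg
      let c := R.turn b (ε * R.sgn a b) a
      R.IsFace a b c (R.turn c (ε * R.sgn a b * R.sgn b c) b) ε)
    (hneg : let R := ofLists L neg
      R.sgn ⟨1, by omega⟩ ⟨4, by omega⟩ * R.sgn ⟨4, by omega⟩ ⟨5, by omega⟩ *
        R.sgn ⟨5, by omega⟩ ⟨1, by omega⟩ = -1) :
    HasJoinQuadrangulation 0 k := by
  have hadj : ∀ w x : Fin (k + 6), (joinGraph (Set.Ico 0 k) fiveGraph).Adj (toJoin w) (toJoin x) ↔
      x ∈ L w := by
    intro w x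
    rw [hG]
    have hw := w.2
    have hx := x.2
    unfold toJoin
    by_cases h₁ : w.1 < 6 <;> by_cases h₂ : x.1 < 6 <;>
      simp only [h₁, h₂, dite_true, dite_false, joinGraph, fiveGraph_adj, Set.mem_Ico] <;>
      split_ifs <;> (try simp only [iff_true, iff_false]) <;> omega
  obtain ⟨R, hR, -, hs⟩ := (isQuadrangulation_ofLists
    (G := (joinGraph (Set.Ico 0 k) fiveGraph).comap toJoin) hL hadj hface).exists_relabel
    (f := toJoin) (G' := joinGraph (Set.Ico 0 k) fiveGraph) toJoin_injective.injOn (by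
      intro y y'
      constructor
      · intro h
        obtain ⟨x, rfl⟩ := exists_toJoin h
        obtain ⟨x', rfl⟩ := exists_toJoin h.symm
        exact ⟨x, x', h, rfl, rfl⟩
      · rintro ⟨x, x', h, rfl, rfl⟩
        exact h)
  refine ⟨R, hR, ?_⟩
  have e : ∀ p : Fin 6, toJoin (⟨p.1, by omega⟩ : Fin (k + 6)) = .inr p := fun p => by
    simp [toJoin]
  have hs' : ∀ p q : Fin 6, fiveGraph.Adj p q →
      R.sgn (.inr p) (.inr q) = (ofLists L neg).sgn ⟨p.1, by omega⟩ ⟨q.1, by omega⟩ := by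
    intro p q hpq
    rw [← e p, ← e q]
    refine hs _ _ ?_
    rw [SimpleGraph.comap_adj, e, e]
    exact hpq
  rw [hs' 1 4 (by decide), hs' 4 5 (by decide), hs' 5 1 (by decide)]
  exact hneg

/-- An explicit quadrangulation with `14` faces. -/
theorem hasJoinQuadrangulation_three : HasJoinQuadrangulation 0 3 :=
  hasJoinQuadrangulation_of_lists
    (L := ![[6, 7, 8], [2, 8, 4, 5, 3, 7, 6], [1, 5, 6, 7, 4, 8, 3], [1, 6, 7, 8, 2, 5, 4],
      [1, 2, 5, 6, 8, 7, 3], [1, 3, 8, 7, 4, 2, 6], [0, 4, 2, 3, 5, 1], [0, 1, 4, 3, 2, 5],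
      [0, 5, 2, 1, 3, 4]])
    (neg := [(4, 5), (2, 6), (2, 7)])
    (by decide +kernel) (by decide +kernel) (by decide +kernel) (by decide +kernel)

/-- An explicit quadrangulation with `17` faces. -/
theorem hasJoinQuadrangulation_four : HasJoinQuadrangulation 0 4 :=
  hasJoinQuadrangulation_of_lists
    (L := ![[6, 7, 8, 9], [2, 3, 5, 4, 9, 8, 7, 6], [1, 4, 5, 3, 7, 8, 9, 6],
      [1, 6, 9, 5, 4, 2, 7, 8], [1, 5, 9, 8, 7, 3, 2, 6], [1, 8, 7, 2, 3, 4, 9, 6],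
      [0, 3, 2, 5, 4, 1], [0, 1, 2, 4, 3, 5], [0, 5, 3, 4, 2, 1], [0, 1, 5, 2, 4, 3]])
    (neg := [(1, 4), (5, 6), (5, 9)])
    (by decide +kernel) (by decide +kernel) (by decide +kernel) (by decide +kernel)

/-- The complete bipartite graph with parts `{0, …, 5}` and `{6, 7, 8, 9}`. -/
def bipartiteGraph : SimpleGraph (Fin 10) where
  Adj x y := ¬ (x < 6 ↔ y < 6)
  symm := ⟨fun _ _ h h' => h h'.symm⟩
  loopless := ⟨fun _ h => h Iff.rfl⟩

instance : DecidableRel bipartiteGraph.Adj := fun x y =>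
  inferInstanceAs (Decidable (¬ (x < 6 ↔ y < 6)))

/-- The rotations alternate between the increasing and the decreasing order on either side, so that
every face is of the form `x, y, x + 1, y + 1`, cyclically in each part. -/
def bipartiteSystem : RotationSystem (Fin 10) :=
  ofLists ![[6, 7, 8, 9], [9, 8, 7, 6], [6, 7, 8, 9], [9, 8, 7, 6], [6, 7, 8, 9], [9, 8, 7, 6],
    [0, 1, 2, 3, 4, 5], [5, 4, 3, 2, 1, 0], [0, 1, 2, 3, 4, 5], [5, 4, 3, 2, 1, 0]] []

theorem isQuadrangulation_bipartiteSystem : bipartiteSystem.IsQuadrangulation bipartiteGraph :=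
  isQuadrangulation_ofLists (by decide +kernel) (by decide +kernel) (by decide +kernel)

/-- The complete graph on four vertices quadrangulates the projective plane, as the quotient of the
cube by the antipodal map. -/
theorem hasNonorientableQuadrangularEmbedding_four :
    HasNonorientableQuadrangularEmbedding (SimpleGraph.completeGraph (Fin 4)) := by
  have h : (ofLists ![[1, 2, 3], [0, 2, 3], [0, 1, 3], [0, 1, 2]]
      [(0, 2), (1, 3)]).IsQuadrangulation (SimpleGraph.completeGraph (Fin 4)) :=
    isQuadrangulation_ofLists (by decide +kernel)
      (fun w x => (SimpleGraph.top_adj w x).trans (by revert w x; decide +kernel)) (by decide +kernel)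
  refine h.hasNonorientableQuadrangularEmbedding (fun v => ⟨v + 1, ?_⟩) (a := 0) (b := 1) (c := 2)
    ?_ ?_ ?_ (by decide +kernel)
  · exact (SimpleGraph.top_adj _ _).2 (by revert v; decide)
  all_goals exact (SimpleGraph.top_adj _ _).2 (by decide)

end RotationSystem

/-! ### Enlarging the join and the complete graph -/

namespace RotationSystem

/-- Two more independent vertices: the diamond sum of a join with the bipartite quadrangulation, at a
vertex of degree six in each, replaces one independent vertex by three. -/
theorem HasJoinQuadrangulation.step {lo hi : ℕ} (hlt : lo < hi) (h : HasJoinQuadrangulation lo hi) :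
    HasJoinQuadrangulation (lo + 1) (hi + 3) := by
  classical
  obtain ⟨R, hR, htri⟩ := h
  obtain ⟨R₁, hR₁, hs₁, ht₁⟩ := hR.exists_sgn_eq_one (.inl lo)
  have hB := isQuadrangulation_bipartiteSystem
  set G₁ := joinGraph (Set.Ico lo hi) fiveGraph with hG₁
  set S : Set ℕ := {i | i = lo ∨ hi ≤ i ∧ i < hi + 3} with hS
  set G₂ := joinGraph S ⊥ with hG₂
  have hn₁ : G₁.neighborSet (.inl lo) = Set.range Sum.inr := by
    ext (i | p)
    · simp [hG₁, joinGraph]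
    · simp [hG₁, joinGraph, hlt]
  have hc₁ : (G₁.neighborSet (.inl lo)).ncard = 6 := by
    rw [hn₁, ← Set.image_univ, Set.ncard_image_of_injective _ Sum.inr_injective, Set.ncard_univ]
    simp
  have hn₂ : bipartiteGraph.neighborSet 6 = ((Finset.univ.filter (· < 6) : Finset (Fin 10)) :
      Set (Fin 10)) := by
    ext x
    simp [bipartiteGraph]
  have hc₂ : (bipartiteGraph.neighborSet 6).ncard = 6 := by
    rw [hn₂, Set.ncard_coe_finset]
    decide
  obtain ⟨F, hF, hFrot⟩ := hB.exists_bijOn_neighborSet hR₁ (hc₂.trans hc₁.symm) (by rw [hc₂]; simp)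
  have hF₁ : ∀ x : Fin 10, x.1 < 6 → ∃ p, F x = .inr p := by
    intro x hx
    have := hF.mapsTo (show x ∈ bipartiteGraph.neighborSet 6 by
      rw [hn₂]; simpa [Fin.lt_def] using hx)
    rw [hn₁] at this
    exact this.imp fun _ h => h.symm
  have hF₂ : ∀ p, ∃ x : Fin 10, x.1 < 6 ∧ F x = .inr p := by
    intro p
    obtain ⟨x, hx, hxp⟩ := hF.surjOn (show Sum.inr p ∈ G₁.neighborSet (.inl lo) by rw [hn₁]; simp)
    rw [hn₂] at hx
    exact ⟨x, by simpa [Fin.lt_def] using hx, hxp⟩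
  have hF₃ : ∀ x y : Fin 10, x.1 < 6 → y.1 < 6 → F x = F y → x = y := by
    intro x y hx hy
    refine fun h => hF.injOn ?_ ?_ h <;> rw [hn₂] <;> simpa [Fin.lt_def]
  let f : Fin 10 → ℕ ⊕ Fin 6 := fun x =>
    if x.1 < 6 then F x else .inl (if x.1 = 6 then lo else hi + (x.1 - 7))
  have hf_lt : ∀ x : Fin 10, x.1 < 6 → f x = F x := fun x hx => by simp [f, hx]
  have hf_ge : ∀ x : Fin 10, ¬ x.1 < 6 → f x = .inl (if x.1 = 6 then lo else hi + (x.1 - 7)) :=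
    fun x hx => by simp [f, hx]
  have hfS : ∀ x : Fin 10, ¬ x.1 < 6 → (if x.1 = 6 then lo else hi + (x.1 - 7)) ∈ S := by
    intro x hx
    have := x.2
    simp only [hS, Set.mem_ofPred_eq]
    split_ifs <;> omega
  have hfS' : ∀ i ∈ S, ∃ x : Fin 10, ¬ x.1 < 6 ∧ f x = .inl i := by
    rintro i (rfl | ⟨h₁, h₂⟩)
    · exact ⟨6, by decide, hf_ge 6 (by decide)⟩
    · refine ⟨⟨i - hi + 7, by omega⟩, by simp, ?_⟩
      rw [hf_ge _ (by simp), if_neg (by simp)]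
      congr 1
      simp only
      omega
  have hfinj : Function.Injective f := by
    intro x y hxy
    by_cases hx : x.1 < 6 <;> by_cases hy : y.1 < 6
    · rw [hf_lt x hx, hf_lt y hy] at hxy
      exact hF₃ x y hx hy hxy
    · obtain ⟨p, hp⟩ := hF₁ x hx
      rw [hf_lt x hx, hf_ge y hy, hp] at hxy
      simp at hxy
    · obtain ⟨p, hp⟩ := hF₁ y hy
      rw [hf_lt y hy, hf_ge x hx, hp] at hxy
      simp at hxy
    · rw [hf_ge x hx, hf_ge y hy] at hxy
      have := Sum.inl.inj hxy
      ext
      split_ifs at this <;> omega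
  have hGf : ∀ y y', G₂.Adj y y' ↔ ∃ x x', bipartiteGraph.Adj x x' ∧ f x = y ∧ f x' = y' := by
    have mixed : ∀ i p, i ∈ S → ∃ x x' : Fin 10, ¬ x.1 < 6 ∧ x'.1 < 6 ∧ f x = .inl i ∧
        f x' = .inr p := by
      intro i p hi
      obtain ⟨x, hx, hxi⟩ := hfS' i hi
      obtain ⟨x', hx', hxp⟩ := hF₂ p
      exact ⟨x, x', hx, hx', hxi, by rw [hf_lt _ hx', hxp]⟩
    intro y y'
    constructor
    · rcases y with i | p <;> rcases y' with j | q <;> intro h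
      · exact h.elim
      · obtain ⟨x, x', hx, hx', h₁, h₂⟩ := mixed i q h
        exact ⟨x, x', by simp [bipartiteGraph, Fin.lt_def, hx, hx'], h₁, h₂⟩
      · obtain ⟨x, x', hx, hx', h₁, h₂⟩ := mixed j p h
        exact ⟨x', x, by simp [bipartiteGraph, Fin.lt_def, hx, hx'], h₂, h₁⟩
      · exact h.elim
    · rintro ⟨x, x', h, rfl, rfl⟩
      by_cases hx : x.1 < 6 <;> by_cases hy : x'.1 < 6
      · simp [bipartiteGraph, Fin.lt_def, hx, hy] at h
      · obtain ⟨p, hp⟩ := hF₁ x hx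
        rw [hf_lt x hx, hf_ge x' hy, hp]
        exact hfS x' hy
      · obtain ⟨p, hp⟩ := hF₁ x' hy
        rw [hf_lt x' hy, hf_ge x hx, hp]
        exact hfS x hx
      · simp [bipartiteGraph, Fin.lt_def, hx, hy] at h
  obtain ⟨R₂, hR₂, hrot₂, hs₂⟩ := hB.exists_relabel hfinj.injOn hGf
  have hf6 : f 6 = .inl lo := hf_ge 6 (by decide)
  have hsum : Summable R₁ R₂ G₁ G₂ (.inl lo) := by
    refine ⟨hR₁, hR₂, ?_, hs₁, ?_, ?_, ?_⟩
    · ext1 y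
      rw [Equiv.Perm.inv_def]
      by_cases hy : G₂.Adj (.inl lo) y
      · rcases y with i | p
        · exact hy.elim
        · obtain ⟨x, hx, hxp⟩ := hF₂ p
          have hadj : bipartiteGraph.Adj 6 x := by
            simpa [bipartiteGraph, Fin.lt_def] using hx
          have hadj' : (bipartiteSystem.rot 6 x).1 < 6 := by
            simpa [bipartiteGraph, Fin.lt_def] using hB.adj_rot hadj
          rw [← hxp, ← hFrot x hadj, ← hf_lt x hx, ← hf6, hrot₂ 6 x hadj, hf_lt _ hadj']
      · rw [hR₂.rot_eq_of_not_adj hy, eq_comm, Equiv.symm_apply_eq, eq_comm]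
        refine hR₁.rot_eq_of_not_adj fun h => hy ?_
        rcases y with i | p
        · exact h.elim
        · exact Or.inl rfl
    · intro y hy
      obtain ⟨x, x', h, h₁, rfl⟩ := (hGf _ _).1 hy
      rw [← h₁, hs₂ x x' h]
      simp [bipartiteSystem, ofLists]
    · rintro (i | p) (j | q) hw hx h₁ h₂
      · exact h₁
      · have h₁ : lo ≤ i ∧ i < hi := h₁
        rcases h₂ with rfl | h₂
        · exact hw rfl
        · omega
      · have h₁ : lo ≤ j ∧ j < hi := h₁
        rcases h₂ with rfl | h₂
        · exact hx rfl
        · omega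
      · exact h₂
    · rintro (i | p) (j | q) (k | r) hw h₁ h₂
      any_goals exact h₁.elim
      any_goals exact h₂.elim
      · have h₁ : lo ≤ i ∧ i < hi := h₁
        rcases h₂ with rfl | h₂
        · exact absurd rfl hw
        · omega
      all_goals exact ⟨le_rfl, hlt⟩
  have hG : diamondGraph G₁ G₂ (.inl lo) = joinGraph (Set.Ico (lo + 1) (hi + 3)) fiveGraph := by
    have mixed : ∀ i, (lo ≤ i ∧ i < hi ∨ (i = lo ∨ hi ≤ i ∧ i < hi + 3)) ∧ i ≠ lo ↔
        lo + 1 ≤ i ∧ i < hi + 3 := by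
      intro i
      omega
    ext (i | p) (j | q)
    · simp [diamondGraph, hG₁, hG₂, joinGraph]
    · simpa [diamondGraph, hG₁, hG₂, joinGraph, hS] using mixed i
    · simpa [diamondGraph, hG₁, hG₂, joinGraph, hS] using mixed j
    · simp [diamondGraph, hG₁, hG₂, joinGraph]
  refine ⟨diamond R₁ R₂ G₁ (.inl lo), hG ▸ hsum.isQuadrangulation, ?_⟩
  have hsgn : ∀ p q, fiveGraph.Adj p q →
      (diamond R₁ R₂ G₁ (.inl lo)).sgn (.inr p) (.inr q) = R₁.sgn (.inr p) (.inr q) :=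
    fun p q hpq => hsum.merges.sgn_left _ _ (by simp) (by simp) hpq
  rw [hsgn 1 4 (by decide), hsgn 4 5 (by decide), hsgn 5 1 (by decide), ht₁, htri]

theorem exists_hasJoinQuadrangulation {k : ℕ} (hk : 3 ≤ k) :
    ∃ lo hi, hi = lo + k ∧ HasJoinQuadrangulation lo hi := by
  induction k using Nat.strong_induction_on with
  | _ k ih =>
    obtain rfl | rfl | h : k = 3 ∨ k = 4 ∨ 5 ≤ k := by omega
    · exact ⟨0, 3, rfl, hasJoinQuadrangulation_three⟩
    · exact ⟨0, 4, rfl, hasJoinQuadrangulation_four⟩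
    · obtain ⟨lo, hi, rfl, h'⟩ := ih (k - 2) (by omega) (by omega)
      exact ⟨lo + 1, lo + (k - 2) + 3, by omega, h'.step (by omega)⟩

/-- The diamond sum of a quadrangulation of a complete graph on `n` vertices and a join with `n - 1`
independent vertices, at the vertex `0` of `fiveGraph`, replaces a vertex of the complete graph
by five. -/
theorem hasNonorientableQuadrangularEmbedding_add_four {n : ℕ} (hn : 4 ≤ n)
    {R : RotationSystem (Fin n)}
    (hR : R.IsQuadrangulation (SimpleGraph.completeGraph (Fin n))) :
    HasNonorientableQuadrangularEmbedding (SimpleGraph.completeGraph (Fin (n + 4))) := by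
  classical
  obtain ⟨lo, hi, hhi, RH, hRH, htri⟩ := exists_hasJoinQuadrangulation (k := n - 1) (by omega)
  let v : Fin n := ⟨0, by omega⟩
  have : Nonempty (Fin n) := ⟨v⟩
  -- The complete graph, with five isolated vertices and a sixth one added.
  let G₁ : SimpleGraph (Fin n ⊕ Fin 6) := SimpleGraph.completeGraph (Fin n) ⊕g ⊥
  obtain ⟨R₀, hR₀, -, -⟩ := hR.exists_relabel (f := Sum.inl) (G' := G₁) Sum.inl_injective.injOn (by
    rintro (x | p) (y | q) <;> simp [G₁])
  obtain ⟨R₁, hR₁, hs₁, -⟩ := hR₀.exists_sgn_eq_one (.inl v)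
  obtain ⟨RJ, hRJ, hsJ, htJ⟩ := hRH.exists_sgn_eq_one (.inr 0)
  rw [← htJ] at htri
  set J := joinGraph (Set.Ico lo hi) fiveGraph with hJ
  have hnJ : J.neighborSet (.inr 0) = Sum.inl '' ((Finset.Ico lo hi : Finset ℕ) : Set ℕ) := by
    ext (i | p) <;> simp [hJ, joinGraph, fiveGraph_adj]
  have hcJ : (J.neighborSet (.inr 0)).ncard = n - 1 := by
    rw [hnJ, Set.ncard_image_of_injective _ Sum.inl_injective, Set.ncard_coe_finset, Nat.card_Ico]
    omega
  have hn₁ : G₁.neighborSet (.inl v) =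
      Sum.inl '' ((Finset.univ.erase v : Finset (Fin n)) : Set (Fin n)) := by
    ext (x | p) <;> simp [G₁, eq_comm]
  have hc₁ : (G₁.neighborSet (.inl v)).ncard = n - 1 := by
    rw [hn₁, Set.ncard_image_of_injective _ Sum.inl_injective, Set.ncard_coe_finset,
      Finset.card_erase_of_mem (Finset.mem_univ v), Finset.card_univ, Fintype.card_fin]
  obtain ⟨F, hF, hFrot⟩ := hRJ.exists_bijOn_neighborSet hR₁ (hcJ.trans hc₁.symm)
    (by rw [hcJ]; omega)
  have hF₁ : ∀ i, lo ≤ i → i < hi → ∃ x, x ≠ v ∧ F (.inl i) = .inl x := by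
    intro i h₁ h₂
    have := hF.mapsTo (show Sum.inl i ∈ J.neighborSet (.inr 0) by rw [hnJ]; simp [h₁, h₂])
    rw [hn₁] at this
    obtain ⟨x, hx, hxi⟩ := this
    exact ⟨x, by simpa using hx, hxi.symm⟩
  have hF₂ : ∀ x, x ≠ v → ∃ i, (lo ≤ i ∧ i < hi) ∧ F (.inl i) = .inl x := by
    intro x hx
    obtain ⟨y, hy, hyx⟩ := hF.surjOn (show Sum.inl x ∈ G₁.neighborSet (.inl v) by
      rw [hn₁]; simp [hx])
    rw [hnJ] at hy
    obtain ⟨i, hi, rfl⟩ := hy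
    exact ⟨i, by simpa using hi, hyx⟩
  have hF₃ : ∀ i j, (lo ≤ i ∧ i < hi) → (lo ≤ j ∧ j < hi) → F (.inl i) = F (.inl j) → i = j := by
    intro i j hi hj h
    refine Sum.inl.inj (hF.injOn ?_ ?_ h) <;> rw [hnJ] <;> simpa
  -- The join, with `0` relabelled as `v`.
  let G₂ : SimpleGraph (Fin n ⊕ Fin 6) :=
    { Adj := fun
        | .inl x, .inl y => x ≠ y ∧ (x = v ∨ y = v)
        | .inl x, .inr p => x ≠ v ∧ p ≠ 0
        | .inr p, .inl x => x ≠ v ∧ p ≠ 0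
        | .inr p, .inr q => fiveGraph.Adj p q
      symm := ⟨by
        rintro (x | p) (y | q) h
        exacts [⟨h.1.symm, h.2.symm⟩, h, h, SimpleGraph.Adj.symm h]⟩
      loopless := ⟨by rintro (x | p) h; exacts [h.1 rfl, fiveGraph.irrefl h]⟩ }
  let f : ℕ ⊕ Fin 6 → Fin n ⊕ Fin 6 :=
    Sum.elim (fun i => F (.inl i)) fun p => if p = 0 then .inl v else .inr p
  have hsupp : ∀ i, .inl i ∈ J.support → lo ≤ i ∧ i < hi := by
    rintro i ⟨j | q, h⟩
    exacts [h.elim, h]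
  have hfinj : Set.InjOn f J.support := by
    rintro (i | p) hi (j | q) hj h
    · rw [hF₃ i j (hsupp i hi) (hsupp j hj) h]
    · obtain ⟨x, hx, hxi⟩ := hF₁ i (hsupp i hi).1 (hsupp i hi).2
      simp only [f, Sum.elim_inl, Sum.elim_inr, hxi] at h
      split_ifs at h
      exact absurd (Sum.inl.inj h) hx
    · obtain ⟨x, hx, hxj⟩ := hF₁ j (hsupp j hj).1 (hsupp j hj).2
      simp only [f, Sum.elim_inl, Sum.elim_inr, hxj] at h
      split_ifs at h
      exact absurd (Sum.inl.inj h).symm hx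
    · simp only [f, Sum.elim_inr] at h
      split_ifs at h with h₁ h₂
      · rw [h₁, h₂]
      · rw [Sum.inr.inj h]
  have hGf : ∀ y y', G₂.Adj y y' ↔ ∃ x x', J.Adj x x' ∧ f x = y ∧ f x' = y' := by
    intro y y'
    constructor
    · rcases y with x | p <;> rcases y' with x' | q
      · rintro ⟨hne, rfl | rfl⟩
        · obtain ⟨i, hi, hix⟩ := hF₂ x' hne.symm
          exact ⟨.inr 0, .inl i, hi, rfl, hix⟩
        · obtain ⟨i, hi, hix⟩ := hF₂ x hne
          exact ⟨.inl i, .inr 0, hi, hix, rfl⟩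
      · rintro ⟨hx, hp⟩
        obtain ⟨i, hi, hix⟩ := hF₂ x hx
        exact ⟨.inl i, .inr q, hi, hix, by simp [f, hp]⟩
      · rintro ⟨hx, hp⟩
        obtain ⟨i, hi, hix⟩ := hF₂ x' hx
        exact ⟨.inr p, .inl i, hi, by simp [f, hp], hix⟩
      · intro h
        have h' : p ≠ q ∧ p ≠ 0 ∧ q ≠ 0 := h
        exact ⟨.inr p, .inr q, h, by simp [f, h'], by simp [f, h']⟩
    · have mixed : ∀ i p, lo ≤ i ∧ i < hi → G₂.Adj (f (.inl i)) (f (.inr p)) := by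
        intro i p hi
        obtain ⟨x, hx, hxi⟩ := hF₁ i hi.1 hi.2
        by_cases hp : p = 0
        · simpa [f, hxi, hp, G₂] using hx
        · simpa [f, hxi, hp, G₂] using hx
      rintro ⟨i | p, j | q, h, rfl, rfl⟩
      · exact h.elim
      · exact mixed i q h
      · exact (mixed j p h).symm
      · have h' : p ≠ q ∧ p ≠ 0 ∧ q ≠ 0 := h
        simpa [f, h', G₂] using (show fiveGraph.Adj p q from h)
  obtain ⟨R₂, hR₂, hrot₂, hs₂⟩ := hRJ.exists_relabel hfinj hGf
  have hf₀ : f (.inr 0) = .inl v := by simp [f]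
  have hsum : Summable R₁ R₂ G₁ G₂ (.inl v) := by
    refine ⟨hR₁, hR₂, ?_, hs₁, ?_, ?_, ?_⟩
    · ext1 y
      rw [Equiv.Perm.inv_def]
      by_cases hy : G₂.Adj (.inl v) y
      · rcases y with x | p
        · obtain ⟨i, hi, hix⟩ := hF₂ x hy.1.symm
          have hadj : J.Adj (.inr 0) (.inl i) := hi
          have hadj' := hRJ.adj_rot hadj
          have hff : ∀ z, J.Adj (.inr 0) z → f z = F z := by
            rintro (j | q) hz
            · rfl
            · exact absurd rfl hz.2.1
          rw [← hix, ← hFrot _ hadj, ← hff _ hadj, ← hff _ hadj', ← hf₀, hrot₂ _ _ hadj]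
        · exact absurd rfl hy.1
      · rw [hR₂.rot_eq_of_not_adj hy, eq_comm, Equiv.symm_apply_eq, eq_comm]
        refine hR₁.rot_eq_of_not_adj fun h => hy ?_
        rcases y with x | p
        · exact ⟨by simpa [G₁] using h, Or.inl rfl⟩
        · simp [G₁] at h
    · intro y hy
      obtain ⟨x, x', h, h₁, rfl⟩ := (hGf _ _).1 hy
      have hx : x = .inr 0 := hfinj ⟨x', h⟩ ⟨.inl lo, by simp [hJ, joinGraph]; omega⟩
        (h₁.trans hf₀.symm)
      subst hx
      rw [← h₁, hs₂ _ x' h, hsJ x' h]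
    · rintro (x | p) (y | q) hw hx h₁ h₂
      · rcases h₂.2 with rfl | rfl
        · exact hw rfl
        · exact hx rfl
      all_goals simp [G₁] at h₁
    · rintro (x | p) (y | q) z hw h₁ h₂
      · simpa [G₁] using hw
      all_goals simp [G₁] at h₁
  -- The sum is the complete graph on all vertices other than `v` and `0`.
  have hG : ∀ y y', (diamondGraph G₁ G₂ (.inl v)).Adj y y' ↔
      y ≠ y' ∧ (y ≠ .inl v ∧ y ≠ .inr 0) ∧ (y' ≠ .inl v ∧ y' ≠ .inr 0) := by
    rintro (x | p) (y | q)
    · simp only [diamondGraph, G₁, G₂]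
      simp
      tauto
    · simp [diamondGraph, G₁, G₂]
      tauto
    · simp [diamondGraph, G₁, G₂]
      tauto
    · have : fiveGraph.Adj p q ↔ p ≠ q ∧ p ≠ 0 ∧ q ≠ 0 := Iff.rfl
      simp [diamondGraph, G₁, G₂, this]
  let g : Fin n ⊕ Fin 6 → Fin (n + 4) :=
    Sum.elim (fun x => ⟨x.1 - 1, by omega⟩) fun p => ⟨n + p.1 - 2, by omega⟩
  have hgl : ∀ x : Fin n, (g (.inl x)).1 = x.1 - 1 := fun _ => rfl
  have hgr : ∀ p : Fin 6, (g (.inr p)).1 = n + p.1 - 2 := fun _ => rfl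
  have hv : ∀ x : Fin n, (Sum.inl x : Fin n ⊕ Fin 6) ≠ .inl v ↔ x.1 ≠ 0 := fun x => by
    simp [v, Fin.ext_iff]
  have h0 : ∀ p : Fin 6, (Sum.inr p : Fin n ⊕ Fin 6) ≠ .inr 0 ↔ p.1 ≠ 0 := fun p => by
    rw [Ne, Sum.inr.injEq, Fin.ext_iff]
    rfl
  have hginj : ∀ y y', (y ≠ .inl v ∧ y ≠ .inr 0) → (y' ≠ .inl v ∧ y' ≠ .inr 0) → g y = g y' →
      y = y' := by
    rintro (x | p) (y | q) hy hy' h <;> rw [Fin.ext_iff] at h <;> simp only [hgl, hgr] at h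
    · have h₁ := (hv x).1 hy.1
      have h₂ := (hv y).1 hy'.1
      congr 1
      ext
      omega
    · have h₁ := (hv x).1 hy.1
      have h₂ := (h0 q).1 hy'.2
      omega
    · have h₁ := (h0 p).1 hy.2
      have h₂ := (hv y).1 hy'.1
      omega
    · congr 1
      ext
      omega
  have hgsurj : ∀ z, ∃ y, (y ≠ .inl v ∧ y ≠ .inr 0) ∧ g y = z := by
    intro z
    by_cases hz : z.1 + 1 < n
    · refine ⟨.inl ⟨z.1 + 1, hz⟩, ⟨(hv _).2 (by simp), by simp⟩, ?_⟩
      ext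
      simp [hgl]
    · refine ⟨.inr ⟨z.1 + 2 - n, by omega⟩, ⟨by simp, (h0 _).2 (by simp; omega)⟩, ?_⟩
      ext
      simp only [hgr]
      omega
  obtain ⟨R₃, hR₃, -, hs₃⟩ := hsum.isQuadrangulation.exists_relabel
    (f := g) (G' := SimpleGraph.completeGraph (Fin (n + 4)))
    (by
      rintro y ⟨y', hy⟩ z ⟨z', hz⟩ h
      exact hginj y z ((hG _ _).1 hy).2.1 ((hG _ _).1 hz).2.1 h)
    (by
      intro z z'
      constructor
      · intro h
        obtain ⟨y, hy, rfl⟩ := hgsurj z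
        obtain ⟨y', hy', rfl⟩ := hgsurj z'
        exact ⟨y, y', (hG _ _).2 ⟨fun h' => h.ne (by rw [h']), hy, hy'⟩, rfl, rfl⟩
      · rintro ⟨y, y', h, rfl, rfl⟩
        rw [hG] at h
        exact (SimpleGraph.top_adj _ _).2 fun h' => h.1 (hginj _ _ h.2.1 h.2.2 h'))
  have hsgn : ∀ p q, fiveGraph.Adj p q →
      R₃.sgn (g (.inr p)) (g (.inr q)) = RJ.sgn (.inr p) (.inr q) := by
    intro p q hpq
    have h' : p ≠ q ∧ p ≠ 0 ∧ q ≠ 0 := hpq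
    have hJpq : J.Adj (.inr p) (.inr q) := hpq
    have hfp : f (.inr p) = .inr p := by simp [f, h']
    have hfq : f (.inr q) = .inr q := by simp [f, h']
    rw [hs₃ _ _ ((hG _ _).2 (by simpa using ⟨h'.1, h'.2.1, h'.2.2⟩)),
      hsum.merges.sgn_right _ _ (by simp) (by simp) hpq, ← hfp, ← hfq, hs₂ _ _ hJpq]
  have hadj : ∀ p q, fiveGraph.Adj p q →
      (SimpleGraph.completeGraph (Fin (n + 4))).Adj (g (.inr p)) (g (.inr q)) := by
    intro p q hpq
    refine (SimpleGraph.top_adj _ _).2 fun h => hpq.1 ?_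
    rw [Fin.ext_iff, hgr, hgr] at h
    ext
    omega
  refine hR₃.hasNonorientableQuadrangularEmbedding (fun x => ?_)
    (hadj 1 4 (by decide)) (hadj 4 5 (by decide)) (hadj 5 1 (by decide)) ?_
  · have : Nontrivial (Fin (n + 4)) := Fin.nontrivial_iff_two_le.2 (by omega)
    exact (exists_ne x).imp fun y hy => (SimpleGraph.top_adj _ _).2 hy.symm
  · rw [hsgn 1 4 (by decide), hsgn 4 5 (by decide), hsgn 5 1 (by decide), htri]

end RotationSystem

open RotationSystem in
/-- A facial walk of a quadrangular embedding visits four different vertices. -/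
lemma CellularEmbedding.IsQuadrangular.four_le {n : ℕ} (hn : n ≠ 0)
    {Φ : CellularEmbedding (SimpleGraph.completeGraph (Fin n))} (hΦ : Φ.IsQuadrangular) :
    4 ≤ n := by
  obtain ⟨w, hw⟩ := hΦ.1 ⟨0, Nat.pos_of_ne_zero hn⟩
  simpa using Fintype.card_le_of_injective _ (hΦ.2 (⟨(_, w), hw⟩, 1)).2

theorem lemma4p2 (n : ℕ)
    (h : HasOrientableQuadrangularEmbedding (SimpleGraph.completeGraph (Fin n)) ∨
      HasNonorientableQuadrangularEmbedding (SimpleGraph.completeGraph (Fin n))) :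
    HasNonorientableQuadrangularEmbedding (SimpleGraph.completeGraph (Fin (n + 4))) := by
  obtain ⟨Φ, hΦ⟩ : ∃ Φ : CellularEmbedding (SimpleGraph.completeGraph (Fin n)),
      Φ.IsQuadrangular := by
    rcases h with ⟨Φ, hΦ, -⟩ | ⟨Φ, hΦ, -⟩ <;> exact ⟨Φ, hΦ⟩
  obtain rfl | hn := eq_or_ne n 0
  · -- The empty graph has a quadrangular embedding in the empty surface.
    exact RotationSystem.hasNonorientableQuadrangularEmbedding_four
  · exact RotationSystem.hasNonorientableQuadrangularEmbedding_add_four (hΦ.four_le hn)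
      (RotationSystem.isQuadrangulation_ofEmbedding hΦ)
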